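/- Let $n\ge 1$; write points of $\mathbb R^n$ as $(x,y)$ with $x\in\mathbb R^{n-1}$, $y\in\mathbb R$. *Front-like functions.* A function $g\in L^\infty_{\rm loc}(\mathbb R^n)$ is front-like if there are locally Lipschitz functions $\underline G,\overline G:\mathbb R\to\mathbb R$ that are $C^1$ with positive derivative on $\mathbb R\setminus\{0\}$, such that $\underline G(0)=\overline G(0)=0$ and $\underline G(y)\le g(x,y)\le\overline G(y)$ for all $(x,y)$. *Advection.* Let $(\Omega,\mathcal F,P)$ be a probability space and let $w:\mathbb R\times\Omega\to\mathbb R$ be a mild approximation of white noise: (i) there is $M>0$ with $\|w\|_{C^1(\mathbb R)}\le M$ almost surely; (ii) $E[w(y)]=0$ for all $y$; (iii) $w$ is stationary and, for some $p>3/2$, $\int_0^\infty\rho(y)^{1/p}\,dy<\infty$, where $\rho(y)$ is the supremum of $|P(A\cap B)-P(A)P(B)|/P(B)$ over all $y_1\le y_2$, $A\in\sigma(w(s):s\ge y_2+y)$ and $B\in\sigma(w(s):y_1\le s\le y_2)$ with $P(B)>0$. Let $u(x,y,t)=(u_\perp(x,y,t),\,u_\parallel(x,t)w(y))$, where $u_\perp$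 and $u_\parallel$ are $C^2$ for $t\ge 0$, with values in $\mathbb R^{n-1}$ and $\mathbb R$, and $\|u\|_{C^1(\mathbb R^n\times[0,\infty))}<\infty$ almost surely. *Equations.* For $\epsilon>0$ and $\alpha\in[1,\infty]$ (with $\epsilon^\infty:=0$) consider, in $\mathbb R^n\times(0,\infty)$, the G-equation $$G_t+\epsilon u(x,y,\epsilon^\alpha t)\cdot\nabla G+|\nabla G|=0$$ and the eikonal equation (with $\beta=\infty$, that is, without viscosity) $$v_t+\epsilon u(x,y,\epsilon^\alpha t)\cdot\nabla v+\tfrac12|\nabla v|^2+\tfrac12=0 .$$ A solution with initial datum $v_0$ is a function on $\mathbb R^n\times[0,\infty)$ that is continuous for $t>0$, is a viscosity solution for $t>0$, equals $v_0$ at $t=0$, and attains $v_0$ in the sense that, at $t=0$, its upper and lower semicontinuous envelopes on $\mathbb R^n\times[0,\infty)$ satisfy $v^*\le (v_0)^*$ and $v_*\ge (v_0)_*$. A perturbed traveling wave for one of the equations is a solution of it of the form $y-t+\epsilon^{2/3}\chi(x,\epsilon^{2/3}y,\epsilon^{2/3}t)$ whose initial datum is front-like and globally Lipschitz. **Proposition.**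 Almost surely, the following holds for all $\epsilon>0$ and $\alpha\in[1,\infty]$. Let $G^\epsilon_{\rm ptw}$ and $v^\epsilon_{\rm ptw}$ be perturbed traveling waves for the G-equation and for the eikonal equation, respectively. Let $v_0$ be front-like with $v_0\ge v^\epsilon_{\rm ptw}(\cdot,\cdot,0)$ in $\mathbb R^n$, and let $v^\epsilon$ be a solution of the eikonal equation with initial datum $v_0$. Then, for every $t\ge0$, $$\{(x,y):G^\epsilon_{\rm ptw}(x,y,t)\le0\}\subset\{(x,y):v^\epsilon(x,y,t)\le0\}\subset\{(x,y):v^\epsilon_{\rm ptw}(x,y,t)\le0\}.$$ -/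

import Mathlib

open MeasureTheory ProbabilityTheory Filter Topology Set
open scoped ENNReal

noncomputable section

namespace FrontProp

/-- The space `ℝⁿ` with `n = m + 1`; its points are written `(x, y)`, where `x ∈ ℝᵐ` consists of the
first `m` coordinates and `y ∈ ℝ` is the last one. -/
abbrev Space (m : ℕ) : Type := EuclideanSpace ℝ (Fin (m + 1))

/-- The transverse variable `x ∈ ℝᵐ` of a point `(x, y)`. -/
def xPart {m : ℕ} (z : Space m) : EuclideanSpace ℝ (Fin m) :=
  WithLp.toLp 2 fun i => z i.castSucc

/-- The variable `y ∈ ℝ` of a point `(x, y)`. -/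
def yPart {m : ℕ} (z : Space m) : ℝ := z (Fin.last m)

/-! ### Front-like initial data -/

/-- A function of class `C^{0,1}_loc(ℝ) ∩ C¹_loc(ℝ₋ ∪ ℝ₊)` that has positive derivative on
`ℝ₋ ∪ ℝ₊` and vanishes at the origin. -/
structure IsProfile (g : ℝ → ℝ) : Prop where
  locallyLipschitz : LocallyLipschitz g
  contDiffOn : ContDiffOn ℝ 1 g {0}ᶜ
  deriv_pos : ∀ y, y ≠ 0 → 0 < deriv g y
  map_zero : g 0 = 0

/-- Front-like functions on `ℝⁿ`: locally (essentially) bounded, and trapped between two profiles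
that depend on `y` alone. -/
structure FrontLike {m : ℕ} (g : Space m → ℝ) : Prop where
  locallyBounded : ∀ K : Set (Space m), IsCompact K → MemLp g ⊤ (volume.restrict K)
  exists_profiles : ∃ lo hi : ℝ → ℝ, IsProfile lo ∧ IsProfile hi ∧
    ∀ z, lo (yPart z) ≤ g z ∧ g z ≤ hi (yPart z)

/-! ### Mild white noise and the advection -/

section Noise

variable {Ω : Type*} [MeasurableSpace Ω]

/-- The σ-algebra generated by the variables `w y`, `y ∈ I`. -/
abbrev sigmaOn (w : ℝ → Ω → ℝ) (I : Set ℝ) : MeasurableSpace Ω :=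
  ⨆ y ∈ I, MeasurableSpace.comap (w y) inferInstance

/-- The mixing coefficient: the supremum of `|P(A ∩ B) - P(A) P(B)| / P(B)` over `y₁ ≤ y₂`,
`A ∈ σ(w(s) : s ≥ y₂ + y)` and `B ∈ σ(w(s) : y₁ ≤ s ≤ y₂)`.
Sets `B` of probability zero contribute `0 / 0 = 0`. -/
def mixingCoeff (P : Measure Ω) (w : ℝ → Ω → ℝ) (y : ℝ) : ℝ≥0∞ :=
  ⨆ (y₁ : ℝ) (y₂ : ℝ) (_ : y₁ ≤ y₂) (A : Set Ω) (B : Set Ω)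
    (_ : MeasurableSet[sigmaOn w (Ici (y₂ + y))] A)
    (_ : MeasurableSet[sigmaOn w (Icc y₁ y₂)] B),
    ENNReal.ofReal |P.real (A ∩ B) - P.real A * P.real B| / P B

/-- Mild approximation of white noise: a process that is almost surely bounded in `C¹(ℝ)` by a
deterministic constant, centred, stationary, and strongly mixing with rate `p > 3/2`. -/
structure IsMildWhiteNoise (P : Measure Ω) (w : ℝ → Ω → ℝ) : Prop where
  measurable : ∀ y, Measurable (w y)
  bounded : ∃ M : ℝ, 0 < M ∧ ∀ᵐ ω ∂P, ContDiff ℝ 1 (fun y => w y ω) ∧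
    ∀ y, |w y ω| ≤ M ∧ |deriv (fun y' => w y' ω) y| ≤ M
  centered : ∀ y, ∫ ω, w y ω ∂P = 0
  stationary : ∀ h : ℝ,
    IdentDistrib (fun ω (y : ℝ) => w (y + h) ω) (fun ω (y : ℝ) => w y ω) P P
  mixing : ∃ p : ℝ, 3 / 2 < p ∧ ∫⁻ y in Ioi (0 : ℝ), mixingCoeff P w y ^ (1 / p) < ⊤

end Noise

/-- The closed half-space `ℝⁿ × [0, ∞)` (or `ℝᵐ × [0, ∞)`) of space-time. -/
def closedHalf (X : Type*) : Set (X × ℝ) := univ ×ˢ Ici 0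

/-- The advection `u(x, y, t) = (u_⊥(x, y, t), u_∥(x, t) w(y))`, for one realization of `w`. -/
def advection {m : ℕ} (uperp : Space m → ℝ → EuclideanSpace ℝ (Fin m))
    (upar : EuclideanSpace ℝ (Fin m) → ℝ → ℝ) (w : ℝ → ℝ) (z : Space m) (t : ℝ) : Space m :=
  WithLp.toLp 2
    (Fin.snoc (α := fun _ => ℝ) (fun i => uperp z t i) (upar (xPart z) t * w (yPart z)))

/-- The `C¹` norm of `u` on `ℝⁿ × [0, ∞)` is finite. -/
def HasFiniteC1Norm {m : ℕ} (u : Space m → ℝ → Space m) : Prop :=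
  ∃ C : ℝ, ∀ z t, 0 ≤ t → ‖u z t‖ ≤ C ∧
    ‖fderivWithin ℝ (Function.uncurry u) (closedHalf (Space m)) (z, t)‖ ≤ C

/-- The assumption on the advection: `w` is mild white noise, `u_⊥` and `u_∥` are of class `C²` up to
time `0`, and `u` has finite `C¹` norm almost surely. -/
structure IsAdmissible {Ω : Type*} [MeasurableSpace Ω] (P : Measure Ω) {m : ℕ} (w : ℝ → Ω → ℝ)
    (uperp : Space m → ℝ → EuclideanSpace ℝ (Fin m))
    (upar : EuclideanSpace ℝ (Fin m) → ℝ → ℝ) : Prop where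
  noise : IsMildWhiteNoise P w
  perp : ContDiffOn ℝ 2 (Function.uncurry uperp) (closedHalf (Space m))
  par : ContDiffOn ℝ 2 (Function.uncurry upar) (closedHalf (EuclideanSpace ℝ (Fin m)))
  finiteC1 : ∀ᵐ ω ∂P, HasFiniteC1Norm (advection uperp upar fun y => w y ω)

/-! ### Viscosity solutions of `v_t + H(z, t, ∇v) = 0` -/

section Viscosity

variable {m : ℕ}

/-- Viscosity sub-solutions in `ℝⁿ × (0, ∞)`. -/
def IsSubsolution (H : Space m → ℝ → Space m → ℝ) (v : Space m → ℝ → ℝ) : Prop :=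
  ∀ ψ : Space m × ℝ → ℝ, ContDiff ℝ 1 ψ → ∀ z t, 0 < t →
    IsLocalMax (fun q : Space m × ℝ => v q.1 q.2 - ψ q) (z, t) →
      deriv (fun s => ψ (z, s)) t + H z t (gradient (fun z' => ψ (z', t)) z) ≤ 0

/-- Viscosity super-solutions in `ℝⁿ × (0, ∞)`. -/
def IsSupersolution (H : Space m → ℝ → Space m → ℝ) (v : Space m → ℝ → ℝ) : Prop :=
  ∀ ψ : Space m × ℝ → ℝ, ContDiff ℝ 1 ψ → ∀ z t, 0 < t →
    IsLocalMin (fun q : Space m × ℝ => v q.1 q.2 - ψ q) (z, t) →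
      0 ≤ deriv (fun s => ψ (z, s)) t + H z t (gradient (fun z' => ψ (z', t)) z)

/-- Viscosity solutions of the initial value problem `v_t + H(z, t, ∇v) = 0` in `ℝⁿ × (0, ∞)`,
`v(·, 0) = v₀`. The function is continuous at positive times. As `v₀` may be discontinuous, it is
attained in the sense of semicontinuous envelopes: `(v₀)_* ≤ v_*` and `v^* ≤ (v₀)^*` at `t = 0`
(at a point of continuity of `v₀` this says that `v` is continuous there). -/
structure IsSolution (H : Space m → ℝ → Space m → ℝ) (v₀ : Space m → ℝ)
    (v : Space m → ℝ → ℝ) : Prop where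
  continuousOn : ContinuousOn (Function.uncurry v) (univ ×ˢ Ioi 0)
  sub : IsSubsolution H v
  super : IsSupersolution H v
  initial : ∀ z, v z 0 = v₀ z
  initial_upper : ∀ z,
    limsup (fun q : Space m × ℝ => (v q.1 q.2 : EReal)) (𝓝[closedHalf (Space m)] (z, 0)) ≤
      limsup (fun z' => (v₀ z' : EReal)) (𝓝 z)
  initial_lower : ∀ z,
    liminf (fun z' => (v₀ z' : EReal)) (𝓝 z) ≤
      liminf (fun q : Space m × ℝ => (v q.1 q.2 : EReal)) (𝓝[closedHalf (Space m)] (z, 0))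

/-- `ε ^ α` for `α ∈ [0, ∞]`, with the convention `ε ^ ∞ = 0`. -/
def epsPow (ε : ℝ) (α : ℝ≥0∞) : ℝ := if α = ⊤ then 0 else ε ^ α.toReal

/-- The Hamiltonian `ε u(x, y, ε^α t) · p + |p|` of the G-equation. -/
def geometricH (u : Space m → ℝ → Space m) (ε : ℝ) (α : ℝ≥0∞)
    (z : Space m) (t : ℝ) (p : Space m) : ℝ :=
  ε * inner ℝ (u z (epsPow ε α * t)) p + ‖p‖

/-- The Hamiltonian `ε u(x, y, ε^α t) · p + |p|² / 2 + 1 / 2` of the eikonal equation without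
viscosity (`β = ∞`). -/
def eikonalH (u : Space m → ℝ → Space m) (ε : ℝ) (α : ℝ≥0∞)
    (z : Space m) (t : ℝ) (p : Space m) : ℝ :=
  ε * inner ℝ (u z (epsPow ε α * t)) p + ‖p‖ ^ 2 / 2 + 1 / 2

/-- The function `y - t + ε^{2/3} χ(x, ε^{2/3} y, ε^{2/3} t)`. -/
def ptw (ε : ℝ) (χ : EuclideanSpace ℝ (Fin m) → ℝ → ℝ → ℝ) (z : Space m) (t : ℝ) : ℝ :=
  yPart z - t +
    ε ^ (2 / 3 : ℝ) * χ (xPart z) (ε ^ (2 / 3 : ℝ) * yPart z) (ε ^ (2 / 3 : ℝ) * t)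

/-- `y - t + ε^{2/3} χ(x, ε^{2/3} y, ε^{2/3} t)` is a perturbed traveling wave for the Hamiltonian
`H`: it solves the equation, and its initial datum is front-like and globally Lipschitz.
(Local boundedness of `χ` is a consequence.) -/
structure IsPTW (H : Space m → ℝ → Space m → ℝ) (ε : ℝ)
    (χ : EuclideanSpace ℝ (Fin m) → ℝ → ℝ → ℝ) : Prop where
  solution : IsSolution H (fun z => ptw ε χ z 0) (ptw ε χ)
  frontLike : FrontLike fun z => ptw ε χ z 0
  lipschitz : ∃ K, LipschitzWith K fun z => ptw ε χ z 0

end Viscosity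

end FrontProp

end

/-! Almost surely the drift `ε u` is bounded and Lipschitz in space-time (`exists_isDrift`); for
each such realization the argument is deterministic.

Outer inclusion: it suffices that `ptw ε χv ≤ v` at all times (`eikonal_comparison`). The
Hamiltonian is quadratic and nothing is assumed about growth in space at positive times. The
equation supplies the growth itself: a sub-solution grows at a controlled rate along straight lines
(`IsSubsolution.le_along_line`). Standing still gives an upper bound on the smaller solution, and a
line ending at the origin gives a quadratic lower bound on the larger one. Mixing the smaller one
with an explicit strict sub-solution gains, by convexity of `‖p‖ ^ 2`, room for a quadratic lateral
penalty during a short time (`le_short_time`). The length of that time step is uniform, so finitely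
many steps suffice; then the share of the strict sub-solution tends to zero.

Inner inclusion: since `‖p‖ ≤ ‖p‖ ^ 2 / 2 + 1 / 2`, `v` is a sub-solution of the G-equation. That
equation is homogeneous of degree one, so `exp (k G + c)` is a super-solution along with `G`
(`SuperOn.exp_geometric`). The profiles allow `v₀ ≤ η exp (k G₀)` on any given ball
(`IsProfile.exists_le_exp`), and by finite speed of propagation a ball is enough
(`geometric_comparison`). Hence `v ≤ η (e + 1 + t)` where `G ≤ 0`, and `η → 0`.

Both comparisons rest on doubling of variables in a cylinder (`le_of_le_boundary`). -/

noncomputable section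

namespace FrontProp

section

variable {m : ℕ}

/-! ### Partial derivatives in space-time -/

section Gradient

variable {E : Type*} [NormedAddCommGroup E] [InnerProductSpace ℝ E] [CompleteSpace E]
  {f g : E → ℝ} {p q x : E}

theorem hasGradientAt_add (hf : HasGradientAt f p x) (hg : HasGradientAt g q x) :
    HasGradientAt (fun y => f y + g y) (p + q) x := by
  rw [hasGradientAt_iff_hasFDerivAt] at *
  rw [map_add]
  exact hf.add hg

theorem hasGradientAt_const_mul (c : ℝ) (hf : HasGradientAt f p x) :
    HasGradientAt (fun y => c * f y) (c • p) x := by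
  rw [hasGradientAt_iff_hasFDerivAt] at *
  rw [map_smul]
  exact hf.const_mul c

theorem hasGradientAt_comp {h : ℝ → ℝ} {h' : ℝ} (hh : HasDerivAt h h' (f x))
    (hf : HasGradientAt f p x) : HasGradientAt (fun y => h (f y)) (h' • p) x := by
  rw [hasGradientAt_iff_hasFDerivAt] at *
  rw [map_smul]
  exact hh.comp_hasFDerivAt x hf

theorem hasGradientAt_normSq_sub (y x : E) :
    HasGradientAt (fun z => ‖z - y‖ ^ 2) ((2 : ℝ) • (x - y)) x := by
  rw [hasGradientAt_iff_hasFDerivAt]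
  have h := ((hasFDerivAt_id (𝕜 := ℝ) x).sub_const y).norm_sq
  refine h.congr_fderiv ?_
  ext v
  simp

end Gradient

/-- `f` has time derivative `a` and spatial gradient `p` at `(z, t)`. -/
structure HasPartialsAt (f : Space m × ℝ → ℝ) (z : Space m) (t a : ℝ) (p : Space m) : Prop where
  time : HasDerivAt (fun s => f (z, s)) a t
  space : HasGradientAt (fun z' => f (z', t)) p z

namespace HasPartialsAt

variable {f g : Space m × ℝ → ℝ} {z : Space m} {t a a' : ℝ} {p p' : Space m}

theorem of_contDiff (hf : ContDiff ℝ 1 f) (z : Space m) (t : ℝ) :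
    HasPartialsAt f z t (deriv (fun s => f (z, s)) t) (gradient (fun z' => f (z', t)) z) := by
  have hd : Differentiable ℝ f := hf.differentiable one_ne_zero
  constructor
  · exact DifferentiableAt.hasDerivAt
      ((hd (z, t)).comp t ((differentiableAt_const z).prodMk differentiableAt_id))
  · exact DifferentiableAt.hasGradientAt
      ((hd (z, t)).comp z (differentiableAt_id.prodMk (differentiableAt_const t)))

theorem deriv_eq (h : HasPartialsAt f z t a p) : deriv (fun s => f (z, s)) t = a := h.time.deriv

theorem gradient_eq (h : HasPartialsAt f z t a p) : gradient (fun z' => f (z', t)) z = p :=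
  h.space.gradient

theorem add (h : HasPartialsAt f z t a p) (h' : HasPartialsAt g z t a' p') :
    HasPartialsAt (fun q => f q + g q) z t (a + a') (p + p') :=
  ⟨h.time.add h'.time, hasGradientAt_add h.space h'.space⟩

theorem const_mul (c : ℝ) (h : HasPartialsAt f z t a p) :
    HasPartialsAt (fun q => c * f q) z t (c * a) (c • p) :=
  ⟨h.time.const_mul c, hasGradientAt_const_mul c h.space⟩

theorem comp {k : ℝ → ℝ} {k' : ℝ} (hk : HasDerivAt k k' (f (z, t)))
    (h : HasPartialsAt f z t a p) : HasPartialsAt (fun q => k (f q)) z t (k' * a) (k' • p) :=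
  ⟨hk.comp t h.time, hasGradientAt_comp (f := fun z' => f (z', t)) hk h.space⟩

theorem of_time {k : ℝ → ℝ} {k' : ℝ} (hk : HasDerivAt k k' t) (z : Space m) :
    HasPartialsAt (fun q => k q.2) z t k' 0 :=
  ⟨hk, hasGradientAt_const z (k t)⟩

theorem of_space {k : Space m → ℝ} {p : Space m} (hk : HasGradientAt k p z) (t : ℝ) :
    HasPartialsAt (fun q => k q.1) z t 0 p :=
  ⟨hasDerivAt_const t (k z), hk⟩

theorem mul (h : HasPartialsAt f z t a p) (h' : HasPartialsAt g z t a' p') :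
    HasPartialsAt (fun q => f q * g q) z t (a * g (z, t) + f (z, t) * a')
      (g (z, t) • p + f (z, t) • p') := by
  refine ⟨h.time.mul h'.time, ?_⟩
  have h1 := h.space
  have h2 := h'.space
  rw [hasGradientAt_iff_hasFDerivAt] at *
  rw [map_add, map_smul, map_smul]
  exact (h1.mul h2).congr_fderiv (add_comm _ _)

end HasPartialsAt

/-! ### Viscosity inequalities on a set of times -/

/-- The viscosity sub-solution inequality at times in `I`. -/
def SubOn (I : Set ℝ) (H : Space m → ℝ → Space m → ℝ) (v : Space m → ℝ → ℝ) : Prop :=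
  ∀ ψ : Space m × ℝ → ℝ, ContDiff ℝ 1 ψ → ∀ z, ∀ t ∈ I,
    IsLocalMax (fun q : Space m × ℝ => v q.1 q.2 - ψ q) (z, t) →
      deriv (fun s => ψ (z, s)) t + H z t (gradient (fun z' => ψ (z', t)) z) ≤ 0

/-- The viscosity super-solution inequality at times in `I`. -/
def SuperOn (I : Set ℝ) (H : Space m → ℝ → Space m → ℝ) (v : Space m → ℝ → ℝ) : Prop :=
  ∀ ψ : Space m × ℝ → ℝ, ContDiff ℝ 1 ψ → ∀ z, ∀ t ∈ I,
    IsLocalMin (fun q : Space m × ℝ => v q.1 q.2 - ψ q) (z, t) →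
      0 ≤ deriv (fun s => ψ (z, s)) t + H z t (gradient (fun z' => ψ (z', t)) z)

variable {I : Set ℝ} {H H' : Space m → ℝ → Space m → ℝ} {v : Space m → ℝ → ℝ}

theorem IsSubsolution.subOn (h : IsSubsolution H v) (hI : I ⊆ Ioi 0) : SubOn I H v :=
  fun ψ hψ z t ht => h ψ hψ z t (hI ht)

theorem IsSupersolution.superOn (h : IsSupersolution H v) (hI : I ⊆ Ioi 0) : SuperOn I H v :=
  fun ψ hψ z t ht => h ψ hψ z t (hI ht)

theorem SubOn.mono_ham (h : SubOn I H v) (hH : ∀ z, ∀ t ∈ I, ∀ p, H' z t p ≤ H z t p) :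
    SubOn I H' v := fun ψ hψ z t ht hmax =>
  (add_le_add_right (hH z t ht _) _).trans (h ψ hψ z t ht hmax)

/-- Affine change of the unknown in a sub-solution. -/
theorem SubOn.const_mul_add (h : SubOn I H v) {c : ℝ} (hc : 0 < c) {f : Space m × ℝ → ℝ}
    (hf : ContDiff ℝ 1 f) {a : Space m → ℝ → ℝ} {q : Space m → ℝ → Space m}
    (hfp : ∀ z t, HasPartialsAt f z t (a z t) (q z t))
    (hH : ∀ z, ∀ t ∈ I, ∀ p, a z t + H' z t (c • p + q z t) ≤ c * H z t p) :
    SubOn I H' (fun z t => c * v z t + f (z, t)) := by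
  intro ψ hψ z t ht hmax
  have hP := ((HasPartialsAt.of_contDiff hψ z t).add ((hfp z t).const_mul (-1))).const_mul c⁻¹
  have hloc : IsLocalMax (fun r : Space m × ℝ => v r.1 r.2 - c⁻¹ * (ψ r + (-1) * f r)) (z, t) := by
    filter_upwards [hmax] with r hr
    have h1 := mul_le_mul_of_nonneg_left hr (inv_pos.2 hc).le
    simp only [Prod.mk.eta] at h1
    have e : ∀ x y w : ℝ, c⁻¹ * (c * x + y - w) = x - c⁻¹ * (w + (-1) * y) := by
      intro x y w; field_simp; ring
    rwa [e, e] at h1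
  have key := h _ (contDiff_const.mul (hψ.add (contDiff_const.mul hf))) z t ht hloc
  rw [hP.deriv_eq, hP.gradient_eq] at key
  -- The slope is `c⁻¹ • (∇ψ - q)`, so that `c • p + q` is again `∇ψ`.
  have h2 := hH z t ht (c⁻¹ • (gradient (fun z' => ψ (z', t)) z + (-1 : ℝ) • q z t))
  rw [smul_inv_smul₀ hc.ne', neg_one_smul, neg_add_cancel_right] at h2
  rw [neg_one_smul] at key
  have h3 := mul_le_mul_of_nonneg_left key hc.le
  rw [mul_add, mul_inv_cancel_left₀ hc.ne'] at h3
  linarith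

/-- Affine change of the unknown in a super-solution. -/
theorem SuperOn.const_mul_add (h : SuperOn I H v) {c : ℝ} (hc : 0 < c) {f : Space m × ℝ → ℝ}
    (hf : ContDiff ℝ 1 f) {a : Space m → ℝ → ℝ} {q : Space m → ℝ → Space m}
    (hfp : ∀ z t, HasPartialsAt f z t (a z t) (q z t))
    (hH : ∀ z, ∀ t ∈ I, ∀ p, c * H z t p ≤ a z t + H' z t (c • p + q z t)) :
    SuperOn I H' (fun z t => c * v z t + f (z, t)) := by
  intro ψ hψ z t ht hmax
  have hP := ((HasPartialsAt.of_contDiff hψ z t).add ((hfp z t).const_mul (-1))).const_mul c⁻¹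
  have hloc : IsLocalMin (fun r : Space m × ℝ => v r.1 r.2 - c⁻¹ * (ψ r + (-1) * f r)) (z, t) := by
    filter_upwards [hmax] with r hr
    have h1 := mul_le_mul_of_nonneg_left hr (inv_pos.2 hc).le
    simp only [Prod.mk.eta] at h1
    have e : ∀ x y w : ℝ, c⁻¹ * (c * x + y - w) = x - c⁻¹ * (w + (-1) * y) := by
      intro x y w; field_simp; ring
    rwa [e, e] at h1
  have key := h _ (contDiff_const.mul (hψ.add (contDiff_const.mul hf))) z t ht hloc
  rw [hP.deriv_eq, hP.gradient_eq] at key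
  have h2 := hH z t ht (c⁻¹ • (gradient (fun z' => ψ (z', t)) z + (-1 : ℝ) • q z t))
  rw [smul_inv_smul₀ hc.ne', neg_one_smul, neg_add_cancel_right] at h2
  rw [neg_one_smul] at key
  have h3 := mul_le_mul_of_nonneg_left key hc.le
  rw [mul_add, mul_inv_cancel_left₀ hc.ne'] at h3
  linarith

/-- Classical super-solutions are viscosity super-solutions. -/
theorem superOn_of_classical {f : Space m × ℝ → ℝ}
    {a : Space m → ℝ → ℝ} {q : Space m → ℝ → Space m}
    (hfp : ∀ z t, HasPartialsAt f z t (a z t) (q z t))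
    (hH : ∀ z, ∀ t ∈ I, 0 ≤ a z t + H z t (q z t)) : SuperOn I H (fun z t => f (z, t)) := by
  intro ψ hψ z t ht hmin
  have hP := (hfp z t).add ((HasPartialsAt.of_contDiff hψ z t).const_mul (-1))
  have ht0 : IsLocalMin (fun s => f (z, s) + (-1) * ψ (z, s)) t := by
    have hc : Tendsto (fun s : ℝ => (z, s)) (𝓝 t) (𝓝 (z, t)) :=
      (Continuous.prodMk_right z).tendsto t
    filter_upwards [hc.eventually hmin] with s hs
    linarith
  have hz0 : IsLocalMin (fun z' => f (z', t) + (-1) * ψ (z', t)) z := by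
    have hc : Tendsto (fun z' : Space m => (z', t)) (𝓝 z) (𝓝 (z, t)) :=
      (Continuous.prodMk_left t).tendsto z
    filter_upwards [hc.eventually hmin] with s hs
    linarith
  have e1 := ht0.hasDerivAt_eq_zero hP.time
  have e2 := hz0.hasFDerivAt_eq_zero (hasGradientAt_iff_hasFDerivAt.1 hP.space)
  rw [map_eq_zero_iff _ (InnerProductSpace.toDual ℝ (Space m)).injective] at e2
  have e3 : gradient (fun z' => ψ (z', t)) z = q z t := by
    rw [neg_one_smul, add_neg_eq_zero] at e2; exact e2.symm
  rw [e3, show deriv (fun s => ψ (z, s)) t = a z t by linarith]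
  exact hH z t ht

/-! ### Auxiliary penalty functions -/

/-- The square of the positive part. -/
def posSq (r : ℝ) : ℝ := max r 0 ^ 2

theorem posSq_nonneg (r : ℝ) : 0 ≤ posSq r := sq_nonneg _

theorem posSq_of_nonpos {r : ℝ} (h : r ≤ 0) : posSq r = 0 := by simp [posSq, h]

theorem posSq_of_nonneg {r : ℝ} (h : 0 ≤ r) : posSq r = r ^ 2 := by simp [posSq, h]

theorem posSq_mono : Monotone posSq := fun _ _ h =>
  pow_le_pow_left₀ (le_max_right _ _) (max_le_max_right _ h) 2

theorem hasDerivAt_posSq (r : ℝ) : HasDerivAt posSq (2 * max r 0) r := by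
  rcases lt_trichotomy r 0 with h | h | h
  · rw [max_eq_right h.le, mul_zero]
    refine (hasDerivAt_const r (0 : ℝ)).congr_of_eventuallyEq ?_
    filter_upwards [Iio_mem_nhds h] with s hs using posSq_of_nonpos (le_of_lt hs)
  · subst h
    rw [max_self, mul_zero]
    rw [hasDerivAt_iff_isLittleO_nhds_zero]
    simp only [zero_add, smul_zero, sub_zero, posSq_of_nonpos le_rfl]
    have h1 : (fun h : ℝ => posSq h) =O[𝓝 0] fun h : ℝ => h ^ 2 := by
      refine Asymptotics.IsBigO.of_bound 1 (Eventually.of_forall fun h => ?_)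
      rw [Real.norm_of_nonneg (posSq_nonneg h), Real.norm_of_nonneg (sq_nonneg h), one_mul]
      rcases le_total h 0 with h0 | h0
      · rw [posSq_of_nonpos h0]; positivity
      · rw [posSq_of_nonneg h0]
    exact h1.trans_isLittleO (Asymptotics.isLittleO_pow_id one_lt_two)
  · rw [max_eq_left h.le]
    have h2 : HasDerivAt (fun s : ℝ => s ^ 2) (2 * r) r := by simpa using hasDerivAt_pow 2 r
    refine h2.congr_of_eventuallyEq ?_
    filter_upwards [Ioi_mem_nhds h] with s hs using posSq_of_nonneg (le_of_lt hs)

theorem contDiff_posSq : ContDiff ℝ 1 posSq := by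
  rw [contDiff_one_iff_deriv]
  refine ⟨fun r => (hasDerivAt_posSq r).differentiableAt, ?_⟩
  rw [show deriv posSq = fun r => 2 * max r 0 from funext fun r => (hasDerivAt_posSq r).deriv]
  fun_prop

/-- The smoothed norm `√(1 + |z|²)`. -/
def jap (z : Space m) : ℝ := √(1 + ‖z‖ ^ 2)

theorem one_le_jap (z : Space m) : 1 ≤ jap z :=
  Real.one_le_sqrt.2 (by nlinarith [sq_nonneg ‖z‖])

theorem norm_le_jap (z : Space m) : ‖z‖ ≤ jap z :=
  Real.le_sqrt_of_sq_le (by linarith)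

theorem contDiff_jap : ContDiff ℝ 1 (jap : Space m → ℝ) :=
  (contDiff_const.add (contDiff_id.norm_sq ℝ)).sqrt fun z => by
    have := sq_nonneg ‖z‖
    simp only [id]
    positivity

theorem hasGradientAt_jap (z : Space m) : HasGradientAt jap ((jap z)⁻¹ • z) z := by
  have h1 : HasGradientAt (fun x : Space m => 1 + ‖x‖ ^ 2) ((2 : ℝ) • z) z := by
    have := hasGradientAt_add (hasGradientAt_const z (1 : ℝ)) (hasGradientAt_normSq_sub 0 z)
    simpa using this
  have hne : 1 + ‖z‖ ^ 2 ≠ 0 := by positivity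
  have h2 := hasGradientAt_comp (f := fun x : Space m => 1 + ‖x‖ ^ 2) (Real.hasDerivAt_sqrt hne) h1
  rwa [smul_smul, show 1 / (2 * √(1 + ‖z‖ ^ 2)) * 2 = (jap z)⁻¹ by unfold jap; field_simp] at h2

theorem norm_gradient_jap_le (z : Space m) : ‖(jap z)⁻¹ • z‖ ≤ 1 := by
  have h := one_le_jap z
  rw [norm_smul, norm_inv, Real.norm_of_nonneg (by linarith), inv_mul_le_one₀ (by linarith)]
  exact norm_le_jap z

end

section

variable {m : ℕ}

/-! ### Comparison on cylinders -/

/-- The distance-squared test function in space-time. -/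
theorem hasPartialsAt_distSq (N : ℝ) (Y : Space m × ℝ) (z : Space m) (t : ℝ) :
    HasPartialsAt (fun q : Space m × ℝ => N / 2 * (‖q.1 - Y.1‖ ^ 2 + (q.2 - Y.2) ^ 2)) z t
      (N * (t - Y.2)) (N • (z - Y.1)) := by
  have ht : HasDerivAt (fun s : ℝ => (s - Y.2) ^ 2) (2 * (t - Y.2)) t := by
    simpa using ((hasDerivAt_id t).sub_const Y.2).fun_pow 2
  have h := ((HasPartialsAt.of_space (hasGradientAt_normSq_sub Y.1 z) t).add
    (HasPartialsAt.of_time ht z)).const_mul (N / 2)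
  rw [zero_add, add_zero, smul_smul, ← mul_assoc, div_mul_cancel₀ _ two_ne_zero] at h
  exact h

theorem contDiff_distSq (N : ℝ) (Y : Space m × ℝ) :
    ContDiff ℝ 1 (fun q : Space m × ℝ => N / 2 * (‖q.1 - Y.1‖ ^ 2 + (q.2 - Y.2) ^ 2)) :=
  contDiff_const.mul (((contDiff_fst.sub contDiff_const).norm_sq ℝ).add
    ((contDiff_snd.sub contDiff_const).pow 2))

variable {b : Space m → ℝ → Space m} {F : Space m → ℝ} {L η σ T R : ℝ}
  {U V : Space m → ℝ → ℝ}

/-- The inequality obtained at an interior maximum point of the doubled function. -/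
theorem le_of_isMax_doubled (hL : 0 ≤ L)
    (hb : ∀ z z' t t', σ ≤ t → σ ≤ t' → ‖b z t - b z' t'‖ ≤ L * (‖z - z'‖ + |t - t'|))
    (hsub : SubOn (Ioo σ T) (fun z t p => inner ℝ (b z t) p + F p + η) U)
    (hsup : SuperOn (Ioo σ T) (fun z t p => inner ℝ (b z t) p + F p) V)
    {N : ℝ} (hN : 0 ≤ N) {X Y : Space m × ℝ}
    (hX : X ∈ Metric.ball (0 : Space m) R ×ˢ Ioo σ T)
    (hY : Y ∈ Metric.ball (0 : Space m) R ×ˢ Ioo σ T)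
    (hmax : ∀ X' ∈ Metric.closedBall (0 : Space m) R ×ˢ Icc σ T,
      ∀ Y' ∈ Metric.closedBall (0 : Space m) R ×ˢ Icc σ T,
      U X'.1 X'.2 - V Y'.1 Y'.2 - N / 2 * (‖X'.1 - Y'.1‖ ^ 2 + (X'.2 - Y'.2) ^ 2) ≤
        U X.1 X.2 - V Y.1 Y.2 - N / 2 * (‖X.1 - Y.1‖ ^ 2 + (X.2 - Y.2) ^ 2)) :
    η ≤ 2 * L * (N * (‖X.1 - Y.1‖ ^ 2 + (X.2 - Y.2) ^ 2)) := by
  have hsubset : Metric.ball (0 : Space m) R ×ˢ Ioo σ T ⊆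
      Metric.closedBall (0 : Space m) R ×ˢ Icc σ T :=
    prod_mono Metric.ball_subset_closedBall Ioo_subset_Icc_self
  have hopen : IsOpen (Metric.ball (0 : Space m) R ×ˢ Ioo σ T) :=
    Metric.isOpen_ball.prod isOpen_Ioo
  have h1 : IsLocalMax (fun q : Space m × ℝ => U q.1 q.2 -
      N / 2 * (‖q.1 - Y.1‖ ^ 2 + (q.2 - Y.2) ^ 2)) (X.1, X.2) := by
    filter_upwards [hopen.mem_nhds hX] with q hq
    have := hmax q (hsubset hq) Y (hsubset hY)
    linarith
  have h2 : IsLocalMin (fun q : Space m × ℝ => V q.1 q.2 -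
      (-N) / 2 * (‖q.1 - X.1‖ ^ 2 + (q.2 - X.2) ^ 2)) (Y.1, Y.2) := by
    filter_upwards [hopen.mem_nhds hY] with q hq
    have := hmax X (hsubset hX) q (hsubset hq)
    rw [norm_sub_rev q.1, norm_sub_rev Y.1, sub_sq_comm q.2, sub_sq_comm Y.2]
    linarith
  have k1 := hsub _ (contDiff_distSq N Y) X.1 X.2 hX.2 h1
  have k2 := hsup _ (contDiff_distSq (-N) X) Y.1 Y.2 hY.2 h2
  rw [(hasPartialsAt_distSq N Y _ _).deriv_eq, (hasPartialsAt_distSq N Y _ _).gradient_eq] at k1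
  rw [(hasPartialsAt_distSq (-N) X _ _).deriv_eq,
    (hasPartialsAt_distSq (-N) X _ _).gradient_eq,
    show (-N) • (Y.1 - X.1) = N • (X.1 - Y.1) by rw [neg_smul, ← smul_neg, neg_sub]] at k2
  -- Both test functions have the same time derivative and the same gradient at the contact points,
  -- so these and `F` cancel; only the variation of the drift is left to balance `η`.
  have k3 : η ≤ inner ℝ (b Y.1 Y.2 - b X.1 X.2) (N • (X.1 - Y.1)) := by
    rw [inner_sub_left]; linarith
  have k4 := real_inner_le_norm (b Y.1 Y.2 - b X.1 X.2) (N • (X.1 - Y.1))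
  have k5 := hb Y.1 X.1 Y.2 X.2 hY.2.1.le hX.2.1.le
  rw [norm_smul, Real.norm_of_nonneg hN] at k4
  rw [norm_sub_rev Y.1, abs_sub_comm] at k5
  have k6 := mul_le_mul_of_nonneg_right k5 (mul_nonneg hN (norm_nonneg (X.1 - Y.1)))
  rw [← sq_abs (X.2 - Y.2)]
  set d := ‖X.1 - Y.1‖
  set e := |X.2 - Y.2|
  have k7 : 0 ≤ L * N * (d ^ 2 + 2 * e ^ 2 - e * d) :=
    mul_nonneg (mul_nonneg hL hN) (by nlinarith [sq_nonneg (d - e), sq_nonneg d, sq_nonneg e])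
  nlinarith

/-- Comparison of a strict sub-solution with a super-solution on a cylinder, by doubling the
variables; the functions are assumed to be ordered on the whole boundary of the cylinder. -/
theorem le_of_le_boundary (hL : 0 ≤ L) (hη : 0 < η)
    (hb : ∀ z z' t t', σ ≤ t → σ ≤ t' → ‖b z t - b z' t'‖ ≤ L * (‖z - z'‖ + |t - t'|))
    (hU : ContinuousOn (Function.uncurry U) (Metric.closedBall (0 : Space m) R ×ˢ Icc σ T))
    (hV : ContinuousOn (Function.uncurry V) (Metric.closedBall (0 : Space m) R ×ˢ Icc σ T))
    (hsub : SubOn (Ioo σ T) (fun z t p => inner ℝ (b z t) p + F p + η) U)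
    (hsup : SuperOn (Ioo σ T) (fun z t p => inner ℝ (b z t) p + F p) V)
    (hbd : ∀ z t, ‖z‖ ≤ R → t ∈ Icc σ T → (‖z‖ = R ∨ t = σ ∨ t = T) → U z t ≤ V z t)
    {z : Space m} {t : ℝ} (hz : ‖z‖ ≤ R) (ht : t ∈ Icc σ T) : U z t ≤ V z t := by
  by_contra! hcon
  set K := Metric.closedBall (0 : Space m) R ×ˢ Icc σ T with hKdef
  have hK : IsCompact K := (isCompact_closedBall _ _).prod isCompact_Icc
  have hztK : (z, t) ∈ K := ⟨mem_closedBall_zero_iff.2 hz, ht⟩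
  obtain ⟨X₀, hX₀, hX₀max⟩ := hK.exists_isMaxOn ⟨_, hztK⟩ (hU.sub hV)
  set M := U X₀.1 X₀.2 - V X₀.1 X₀.2 with hM
  have hMmax : ∀ q ∈ K, U q.1 q.2 - V q.1 q.2 ≤ M := fun q hq => hX₀max hq
  have hMpos : 0 < M := lt_of_lt_of_le (sub_pos.2 hcon) (hMmax (z, t) hztK)
  have hcont : ∀ n : ℕ, ContinuousOn (fun r : (Space m × ℝ) × (Space m × ℝ) =>
      U r.1.1 r.1.2 - V r.2.1 r.2.2 -
        (n : ℝ) / 2 * (‖r.1.1 - r.2.1‖ ^ 2 + (r.1.2 - r.2.2) ^ 2)) (K ×ˢ K) := by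
    intro n
    refine ((hU.comp continuousOn_fst fun r hr => hr.1).sub
      (hV.comp continuousOn_snd fun r hr => hr.2)).sub (Continuous.continuousOn ?_)
    fun_prop
  have hex := fun n : ℕ => (hK.prod hK).exists_isMaxOn ⟨(X₀, X₀), hX₀, hX₀⟩ (hcont n)
  choose r hrK hrmax using hex
  set D : (Space m × ℝ) × (Space m × ℝ) → ℝ :=
    fun r => ‖r.1.1 - r.2.1‖ ^ 2 + (r.1.2 - r.2.2) ^ 2 with hD
  have hDc : Continuous D := by fun_prop
  have hD0 : ∀ r, 0 ≤ D r := fun r => by positivity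
  set W : (Space m × ℝ) × (Space m × ℝ) → ℝ := fun r => U r.1.1 r.1.2 - V r.2.1 r.2.2 with hW
  have hWc : ContinuousOn W (K ×ˢ K) :=
    (hU.comp continuousOn_fst fun r hr => hr.1).sub (hV.comp continuousOn_snd fun r hr => hr.2)
  -- The doubled maximum is at least its value at the diagonal point `(X₀, X₀)`, which is `M`.
  have hND : ∀ n : ℕ, (n : ℝ) / 2 * D (r n) ≤ W (r n) - M := by
    intro n
    have h := hrmax n (show (X₀, X₀) ∈ K ×ˢ K from ⟨hX₀, hX₀⟩)
    simp only [mem_ofPred_eq, sub_self, norm_zero] at h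
    simp only [hD, hW]
    linarith
  obtain ⟨a, haK, φ, hφ, hlim⟩ := (hK.prod hK).tendsto_subseq hrK
  have hWlim : Tendsto (fun n => W (r (φ n))) atTop (𝓝 (W a)) :=
    (hWc a haK).tendsto.comp (tendsto_nhdsWithin_iff.2 ⟨hlim, Eventually.of_forall fun n => hrK _⟩)
  have hDlim : Tendsto (fun n => D (r (φ n))) atTop (𝓝 (D a)) := (hDc.tendsto a).comp hlim
  have hφinf : Tendsto (fun n => ((φ n : ℕ) : ℝ) / 2) atTop atTop :=
    (tendsto_natCast_atTop_atTop.comp hφ.tendsto_atTop).atTop_div_const two_pos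
  have hDa : D a = 0 := by
    refine le_antisymm ?_ (hD0 a)
    by_contra! hpos
    have h1 : Tendsto (fun n => ((φ n : ℕ) : ℝ) / 2 * D (r (φ n))) atTop atTop :=
      hφinf.atTop_mul_pos hpos hDlim
    have h2 : Tendsto (fun n => W (r (φ n)) - M) atTop atTop :=
      tendsto_atTop_mono (fun n => hND _) h1
    exact not_tendsto_nhds_of_tendsto_atTop h2 _ (hWlim.sub_const M)
  have ha12 : a.1 = a.2 := by
    have h1 : ‖a.1.1 - a.2.1‖ ^ 2 = 0 := by
      have := sq_nonneg (a.1.2 - a.2.2)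
      have := sq_nonneg ‖a.1.1 - a.2.1‖
      simp only [hD] at hDa; linarith
    have h2 : (a.1.2 - a.2.2) ^ 2 = 0 := by
      simp only [hD] at hDa; linarith
    refine Prod.ext ?_ ?_
    · exact sub_eq_zero.1 (norm_eq_zero.1 (pow_eq_zero_iff two_ne_zero |>.1 h1))
    · exact sub_eq_zero.1 (pow_eq_zero_iff two_ne_zero |>.1 h2)
  have hWaM : M ≤ W a := by
    refine ge_of_tendsto' hWlim fun n => ?_
    have := hND (φ n)
    have := mul_nonneg (show (0 : ℝ) ≤ ((φ n : ℕ) : ℝ) / 2 by positivity) (hD0 (r (φ n)))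
    linarith
  have hWa : W a = U a.1.1 a.1.2 - V a.1.1 a.1.2 := by simp only [hW, ha12]
  -- The limit point carries the positive maximum `M`, which the boundary order excludes.
  have hint : a.1 ∈ Metric.ball (0 : Space m) R ×ˢ Ioo σ T := by
    have hin : ‖a.1.1‖ ≤ R := mem_closedBall_zero_iff.1 haK.1.1
    have hit := haK.1.2
    have hnot : ¬ (‖a.1.1‖ = R ∨ a.1.2 = σ ∨ a.1.2 = T) := fun h => by
      have := hbd _ _ hin hit h
      linarith
    push Not at hnot
    exact ⟨mem_ball_zero_iff.2 (lt_of_le_of_ne hin hnot.1),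
      lt_of_le_of_ne hit.1 hnot.2.1.symm, lt_of_le_of_ne hit.2 hnot.2.2⟩
  -- Squeezed between `0` and `W - M`, the penalization itself vanishes, not merely the distance;
  -- this contradicts the lower bound `η` from `le_of_isMax_doubled`.
  have hNDlim : Tendsto (fun n => ((φ n : ℕ) : ℝ) / 2 * D (r (φ n))) atTop (𝓝 0) := by
    have hMa : W a - M = 0 := by
      have := hMmax a.1 haK.1
      linarith
    rw [← hMa]
    refine tendsto_of_tendsto_of_tendsto_of_le_of_le (g := fun _ => W a - M)
      (by rw [hMa]; exact tendsto_const_nhds) (hWlim.sub_const M) (fun n => ?_) fun n => hND _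
    simp only [hMa]
    exact mul_nonneg (by positivity) (hD0 _)
  have hopen : IsOpen (Metric.ball (0 : Space m) R ×ˢ Ioo σ T) :=
    Metric.isOpen_ball.prod isOpen_Ioo
  have e1 : ∀ᶠ n in atTop, (r (φ n)).1 ∈ Metric.ball (0 : Space m) R ×ˢ Ioo σ T :=
    ((continuous_fst.tendsto a).comp hlim).eventually (hopen.mem_nhds hint)
  have e2 : ∀ᶠ n in atTop, (r (φ n)).2 ∈ Metric.ball (0 : Space m) R ×ˢ Ioo σ T :=
    ((continuous_snd.tendsto a).comp hlim).eventually (hopen.mem_nhds (ha12 ▸ hint))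
  have e3 : ∀ᶠ n in atTop, 4 * L * (((φ n : ℕ) : ℝ) / 2 * D (r (φ n))) < η := by
    have := hNDlim.const_mul (4 * L)
    rw [mul_zero] at this
    exact this.eventually (gt_mem_nhds hη)
  obtain ⟨n, h1, h2, h3⟩ := (e1.and (e2.and e3)).exists
  have := le_of_isMax_doubled hL hb hsub hsup (Nat.cast_nonneg (φ n)) h1 h2
    (fun X' hX' Y' hY' => hrmax (φ n) (show (X', Y') ∈ K ×ˢ K from ⟨hX', hY'⟩))
  simp only [hD] at h3
  linarith

/-- Comparison on a cylinder with data on the parabolic boundary. -/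
theorem le_of_le_parabolicBoundary (hL : 0 ≤ L) (hη : 0 < η)
    (hb : ∀ z z' t t', σ ≤ t → σ ≤ t' → ‖b z t - b z' t'‖ ≤ L * (‖z - z'‖ + |t - t'|))
    (hU : ContinuousOn (Function.uncurry U) (Metric.closedBall (0 : Space m) R ×ˢ Icc σ T))
    (hV : ContinuousOn (Function.uncurry V) (Metric.closedBall (0 : Space m) R ×ˢ Icc σ T))
    (hsub : SubOn (Ioo σ T) (fun z t p => inner ℝ (b z t) p + F p + η) U)
    (hsup : SuperOn (Ioo σ T) (fun z t p => inner ℝ (b z t) p + F p) V)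
    (hbd : ∀ z t, ‖z‖ ≤ R → t ∈ Icc σ T → (‖z‖ = R ∨ t = σ) → U z t ≤ V z t)
    {z : Space m} {t : ℝ} (hz : ‖z‖ ≤ R) (ht : t ∈ Ico σ T) : U z t ≤ V z t := by
  set K := Metric.closedBall (0 : Space m) R ×ˢ Icc σ T with hKdef
  have hK : IsCompact K := (isCompact_closedBall _ _).prod isCompact_Icc
  have hztK : (z, t) ∈ K := ⟨mem_closedBall_zero_iff.2 hz, Ico_subset_Icc_self ht⟩
  obtain ⟨X₀, hX₀, hX₀max⟩ := hK.exists_isMaxOn ⟨_, hztK⟩ (hU.sub hV)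
  set M := U X₀.1 X₀.2 - V X₀.1 X₀.2 with hM
  have hMmax : ∀ q ∈ K, U q.1 q.2 - V q.1 q.2 ≤ M := fun q hq => hX₀max hq
  have hTt : 0 < T - t := sub_pos.2 ht.2
  -- The barrier `κ * posSq (s - t)` equals `|M|` at time `T`, enough to order the functions there,
  -- and vanishes up to time `t`, so nothing is lost at `(z, t)`. Being nondecreasing in time it
  -- preserves super-solutions.
  set κ := |M| / (T - t) ^ 2 with hκ
  have hκ0 : 0 ≤ κ := by positivity
  have hpc : ContDiff ℝ 1 fun q : Space m × ℝ => κ * posSq (q.2 - t) :=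
    contDiff_const.mul (contDiff_posSq.comp (contDiff_snd.sub contDiff_const))
  have hp : ∀ (z' : Space m) (s : ℝ), HasPartialsAt (fun q => κ * posSq (q.2 - t)) z' s
      (κ * (2 * max (s - t) 0)) 0 := fun z' s => by
    have := ((hasDerivAt_posSq (s - t)).comp s ((hasDerivAt_id s).sub_const t)).const_mul κ
    rw [mul_one] at this
    exact HasPartialsAt.of_time this z'
  have hsup' := hsup.const_mul_add (H' := fun z t p => inner ℝ (b z t) p + F p) one_pos hpc hp
    (fun z' s _ p => by
      have : 0 ≤ κ * (2 * max (s - t) 0) := by positivity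
      simpa using this)
  have hV' : ContinuousOn (Function.uncurry fun z s => 1 * V z s + κ * posSq (s - t)) K := by
    have h1 : ContinuousOn (fun q : Space m × ℝ => 1 * V q.1 q.2) K := continuousOn_const.mul hV
    exact h1.add hpc.continuous.continuousOn
  have key := le_of_le_boundary hL hη hb hU hV' hsub hsup' (fun z' s hz' hs hor => ?_) hz
    (Ico_subset_Icc_self ht)
  · simpa [posSq_of_nonpos le_rfl] using key
  · have h0 : 0 ≤ κ * posSq (s - t) := mul_nonneg hκ0 (posSq_nonneg _)
    rw [← or_assoc] at hor
    rcases hor with h | h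
    · have := hbd z' s hz' hs h
      linarith
    · subst h
      rw [posSq_of_nonneg hTt.le, hκ, div_mul_cancel₀ _ (by positivity)]
      have := hMmax (z', s) ⟨mem_closedBall_zero_iff.2 hz', hs⟩
      have := le_abs_self M
      simp only at *
      linarith

end

section

variable {m : ℕ}

/-- A bounded drift, Lipschitz in space and time, at nonnegative times. -/
structure IsDrift (b : Space m → ℝ → Space m) (B L : ℝ) : Prop where
  bound_nonneg : 0 ≤ B
  lip_nonneg : 0 ≤ L
  norm_le : ∀ z t, 0 ≤ t → ‖b z t‖ ≤ B
  lip : ∀ z z' t t', 0 ≤ t → 0 ≤ t' → ‖b z t - b z' t'‖ ≤ L * (‖z - z'‖ + |t - t'|)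

theorem IsDrift.neg_le_inner {b : Space m → ℝ → Space m} {B L : ℝ} (hb : IsDrift b B L)
    (z : Space m) {t : ℝ} (ht : 0 ≤ t) (p : Space m) : -(B * ‖p‖) ≤ inner ℝ (b z t) p := by
  have h1 := neg_le_of_abs_le (abs_real_inner_le_norm (b z t) p)
  have h2 := mul_le_mul_of_nonneg_right (hb.norm_le z t ht) (norm_nonneg p)
  linarith

theorem IsDrift.inner_le {b : Space m → ℝ → Space m} {B L : ℝ} (hb : IsDrift b B L)
    (z : Space m) {t : ℝ} (ht : 0 ≤ t) (p : Space m) : inner ℝ (b z t) p ≤ B * ‖p‖ :=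
  (real_inner_le_norm _ _).trans
    (mul_le_mul_of_nonneg_right (hb.norm_le z t ht) (norm_nonneg p))

variable {b : Space m → ℝ → Space m} {B L : ℝ}

theorem ContinuousOn.mono_cylinder {v : Space m → ℝ → ℝ}
    (hv : ContinuousOn (Function.uncurry v) (univ ×ˢ Ioi 0)) {σ : ℝ} (hσ : 0 < σ) (R T : ℝ) :
    ContinuousOn (Function.uncurry v) (Metric.closedBall (0 : Space m) R ×ˢ Icc σ T) :=
  hv.mono (prod_mono (subset_univ _) fun _ hs => lt_of_lt_of_le hσ hs.1)

/-! ### Sub-solutions along straight lines -/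

/-- A paraboloid carried along the line `z + (r - s) • q`, the barrier of
`IsSubsolution.le_along_line`. -/
theorem hasPartialsAt_normSq_line (A c₀ c₁ s : ℝ) (z q x : Space m) (t : ℝ) :
    HasPartialsAt (fun r : Space m × ℝ =>
        c₀ + c₁ * (r.2 - s) + A * ‖r.1 - (z + (r.2 - s) • q)‖ ^ 2) x t
      (c₁ + A * (2 * inner ℝ (x - (z + (t - s) • q)) (-q)))
      (A • (2 : ℝ) • (x - (z + (t - s) • q))) := by
  constructor
  · have h1 : HasDerivAt (fun r : ℝ => x - (z + (r - s) • q)) (-q) t := by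
      have := ((((hasDerivAt_id t).sub_const s).smul_const q).const_add z).const_sub x
      simpa using this
    have h2 : HasDerivAt (fun r : ℝ => c₀ + c₁ * (r - s)) c₁ t := by
      simpa using (((hasDerivAt_id t).sub_const s).const_mul c₁).const_add c₀
    exact h2.add (h1.norm_sq.const_mul A)
  · have := hasGradientAt_add (hasGradientAt_const x (c₀ + c₁ * (t - s)))
      (hasGradientAt_const_mul A (hasGradientAt_normSq_sub (z + (t - s) • q) x))
    rwa [zero_add] at this

/-- Growth of a sub-solution of the eikonal equation along a straight line. -/
theorem IsSubsolution.le_along_line (hb : IsDrift b B L) {v : Space m → ℝ → ℝ}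
    (hv : ContinuousOn (Function.uncurry v) (univ ×ˢ Ioi 0))
    (hsub : IsSubsolution (fun z t p => inner ℝ (b z t) p + (‖p‖ ^ 2 / 2 + 1 / 2)) v)
    {s t : ℝ} (hs : 0 < s) (hst : s ≤ t) (z q : Space m) :
    v (z + (t - s) • q) t ≤ v z s + (B + ‖q‖) ^ 2 / 2 * (t - s) := by
  refine le_of_forall_pos_le_add fun η hη => ?_
  set R := ‖z‖ + (t + 1 - s) * ‖q‖ + 1 with hR
  set K := Metric.closedBall (0 : Space m) R ×ˢ Icc s (t + 1) with hKdef
  have hvK : ContinuousOn (Function.uncurry v) K := ContinuousOn.mono_cylinder hv hs R (t + 1)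
  have hK : IsCompact K := (isCompact_closedBall _ _).prod isCompact_Icc
  obtain ⟨M, hM⟩ := hK.exists_bound_of_continuousOn hvK
  have hγ : ∀ r ∈ Icc s (t + 1), ‖z + (r - s) • q‖ ≤ R - 1 := by
    intro r hr
    have h1 := norm_add_le z ((r - s) • q)
    rw [norm_smul, Real.norm_of_nonneg (sub_nonneg.2 hr.1)] at h1
    have h2 : (r - s) * ‖q‖ ≤ (t + 1 - s) * ‖q‖ :=
      mul_le_mul_of_nonneg_right (by linarith [hr.2]) (norm_nonneg q)
    linarith
  have hzR : ‖z‖ ≤ R - 1 := by simpa using hγ s ⟨le_rfl, by linarith⟩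
  have hzs : |v z s| ≤ M := hM (z, s) ⟨mem_closedBall_zero_iff.2 (by linarith), le_rfl, by linarith⟩
  have hM0 : 0 ≤ M := (abs_nonneg _).trans hzs
  obtain ⟨δ, hδ, hδ1, hδv⟩ : ∃ δ, 0 < δ ∧ δ ≤ 1 ∧ ∀ x, ‖x - z‖ < δ → v x s < v z s + η := by
    have hc : ContinuousAt (fun x => v x s) z := by
      have h1 : ContinuousAt (Function.uncurry v) (z, s) :=
        hv.continuousAt ((isOpen_univ.prod isOpen_Ioi).mem_nhds ⟨mem_univ _, hs⟩)
      exact ContinuousAt.comp (f := fun x => (x, s)) h1 (Continuous.prodMk_left s).continuousAt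
    obtain ⟨δ, hδ, h⟩ := Metric.eventually_nhds_iff.1
      (hc.eventually (gt_mem_nhds (lt_add_of_pos_right (v z s) hη)))
    exact ⟨min δ 1, lt_min hδ one_pos, min_le_right _ _, fun x hx =>
      h (by rw [dist_eq_norm]; exact hx.trans_le (min_le_left _ _))⟩
  -- Steep enough that at distance `δ` or more from the line the paraboloid exceeds the oscillation
  -- of `v` on the cylinder.
  set A := 2 * M / δ ^ 2 with hA
  have hA0 : 0 ≤ A := by positivity
  have hAδ : A * δ ^ 2 = 2 * M := div_mul_cancel₀ _ (by positivity)
  have hbig : ∀ x, ∀ r ∈ Icc s (t + 1), ‖x‖ ≤ R → ∀ d : ℝ, δ ≤ d →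
      v x r ≤ v z s + A * d ^ 2 := by
    intro x r hr hx d hd
    have h1 := (abs_le.1 (hM (x, r) ⟨mem_closedBall_zero_iff.2 hx, hr⟩)).2
    have h2 := (abs_le.1 hzs).1
    have h3 : A * δ ^ 2 ≤ A * d ^ 2 :=
      mul_le_mul_of_nonneg_left (pow_le_pow_left₀ hδ.le hd 2) hA0
    simp only [Function.uncurry] at h1
    linarith
  have hpart := hasPartialsAt_normSq_line A (v z s + η) ((B + ‖q‖) ^ 2 / 2) s z q
  have hsup : SuperOn (Ioo s (t + 1)) (fun z t p => inner ℝ (b z t) p + ‖p‖ ^ 2 / 2)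
      (fun x r => v z s + η + (B + ‖q‖) ^ 2 / 2 * (r - s) + A * ‖x - (z + (r - s) • q)‖ ^ 2) := by
    refine superOn_of_classical hpart fun x r hr => ?_
    have h1 := hb.neg_le_inner x (hs.le.trans hr.1.le) (A • (2 : ℝ) • (x - (z + (r - s) • q)))
    set p := A • (2 : ℝ) • (x - (z + (r - s) • q)) with hp
    have h2 : A * (2 * inner ℝ (x - (z + (r - s) • q)) (-q)) = - inner ℝ p q := by
      rw [hp, inner_smul_left, inner_smul_left, inner_neg_right]; simp
    have h3 := real_inner_le_norm p q
    rw [h2]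
    -- The sum is at least `(B + ‖q‖ - ‖p‖) ^ 2 / 2`; this dictates the growth rate `(B + ‖q‖) ^ 2 /
    -- 2`.
    nlinarith [sq_nonneg (B + ‖q‖ - ‖p‖)]
  -- The constant `1 / 2` of the eikonal Hamiltonian, absent from the barrier's equation, serves as
  -- the strictness `η`.
  have key := le_of_le_parabolicBoundary (R := R) (η := 1 / 2) hb.lip_nonneg (by norm_num)
    (fun x x' r r' hr hr' => hb.lip x x' r r' (hs.le.trans hr) (hs.le.trans hr')) hvK ?_
    ((hsub.subOn (I := Ioo s (t + 1)) fun r hr => hs.trans hr.1).mono_ham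
      fun x r _ p => (add_assoc _ _ _).le) hsup ?_
    (z := z + (t - s) • q) (t := t) ?_ ⟨hst, by linarith⟩
  · simp only [sub_self, norm_zero] at key
    linarith
  · have : Continuous (fun r : Space m × ℝ => v z s + η + (B + ‖q‖) ^ 2 / 2 * (r.2 - s) +
        A * ‖r.1 - (z + (r.2 - s) • q)‖ ^ 2) := by fun_prop
    exact this.continuousOn
  · intro x r hx hr hor
    have hpos : 0 ≤ (B + ‖q‖) ^ 2 / 2 * (r - s) :=
      mul_nonneg (by positivity) (sub_nonneg.2 hr.1)
    rcases hor with h | h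
    · have h1 := hγ r hr
      have h2 := norm_sub_norm_le x (z + (r - s) • q)
      have := hbig x r hr hx ‖x - (z + (r - s) • q)‖ (by linarith)
      linarith
    · subst h
      simp only [sub_self, zero_smul, add_zero, mul_zero]
      rcases lt_or_ge ‖x - z‖ δ with h | h
      · have := hδv x h
        have : 0 ≤ A * ‖x - z‖ ^ 2 := by positivity
        linarith
      · have := hbig x r hr hx _ h
        linarith
  · have := hγ t ⟨hst, by linarith⟩
    linarith

/-! ### Lateral penalties -/

/-- A penalty that vanishes on a shrinking ball and grows quadratically outside of it. -/
def penalty (k₀ k₁ ρ c t₀ : ℝ) (q : Space m × ℝ) : ℝ :=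
  (k₀ + k₁ * (q.2 - t₀)) * posSq (jap q.1 - ρ + c * (q.2 - t₀))

theorem contDiff_penalty (k₀ k₁ ρ c t₀ : ℝ) :
    ContDiff ℝ 1 (penalty k₀ k₁ ρ c t₀ : Space m × ℝ → ℝ) :=
  (contDiff_const.add (contDiff_const.mul (contDiff_snd.sub contDiff_const))).mul
    (contDiff_posSq.comp (((contDiff_jap.comp contDiff_fst).sub contDiff_const).add
      (contDiff_const.mul (contDiff_snd.sub contDiff_const))))

theorem hasPartialsAt_penalty (k₀ k₁ ρ c t₀ : ℝ) (z : Space m) (t : ℝ) :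
    HasPartialsAt (penalty k₀ k₁ ρ c t₀) z t
      (k₁ * posSq (jap z - ρ + c * (t - t₀)) +
        (k₀ + k₁ * (t - t₀)) * (2 * max (jap z - ρ + c * (t - t₀)) 0 * c))
      ((k₀ + k₁ * (t - t₀)) • (2 * max (jap z - ρ + c * (t - t₀)) 0) • (jap z)⁻¹ • z) := by
  have h1 : HasDerivAt (fun s => k₀ + k₁ * (s - t₀)) k₁ t := by
    simpa using (((hasDerivAt_id t).sub_const t₀).const_mul k₁).const_add k₀
  have h2 : HasDerivAt (fun s => -ρ + c * (s - t₀)) c t := by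
    simpa using (((hasDerivAt_id t).sub_const t₀).const_mul c).const_add (-ρ)
  have h3 := (HasPartialsAt.of_space (hasGradientAt_jap z) t).add (HasPartialsAt.of_time h2 z)
  have e : ∀ (z : Space m) s, jap z + (-ρ + c * (s - t₀)) = jap z - ρ + c * (s - t₀) :=
    fun _ _ => by ring
  simp only [e] at h3
  have h4 := (HasPartialsAt.of_time h1 z).mul (h3.comp (k := posSq) (hasDerivAt_posSq _))
  simp only [zero_add, add_zero, smul_zero] at h4
  exact h4

theorem norm_gradient_penalty_le {k r : ℝ} (hk : 0 ≤ k) (z : Space m) :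
    ‖k • (2 * max r 0) • (jap z)⁻¹ • z‖ ≤ k * (2 * max r 0) := by
  have hr : 0 ≤ 2 * max r 0 := by positivity
  rw [norm_smul, norm_smul, Real.norm_of_nonneg hk, Real.norm_of_nonneg hr, ← mul_assoc]
  exact mul_le_of_le_one_right (mul_nonneg hk hr) (norm_gradient_jap_le z)

/-- Convexity of the square with weights `1 - μ` and `μ`. It separates the gradient of the penalty
from that of the solution at the price of a factor close to one. -/
theorem add_sq_le_div_add_div {μ : ℝ} (h0 : 0 < μ) (h1 : μ < 1) (x y : ℝ) :
    (x + y) ^ 2 ≤ x ^ 2 / (1 - μ) + y ^ 2 / μ := by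
  have h2 : 0 < 1 - μ := by linarith
  rw [div_add_div _ _ h2.ne' h0.ne', le_div_iff₀ (mul_pos h2 h0)]
  nlinarith [sq_nonneg (μ * x - (1 - μ) * y)]

/-- A super-solution of the eikonal equation plus a lateral penalty is, for a short time, a
super-solution of a slightly less coercive equation. -/
theorem SuperOn.add_penalty_eikonal (hb : IsDrift b B L) {v : Space m → ℝ → ℝ}
    {t₀ τ μ k η ρ : ℝ} (ht₀ : 0 ≤ t₀) (hτ : 0 < τ) (hμ0 : 0 < μ) (hμ1 : μ < 1) (hk : 0 < k)
    (hτk : 8 * k * τ ≤ μ)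
    (hv : SuperOn (Ioo t₀ (t₀ + τ)) (fun z t p => inner ℝ (b z t) p + (‖p‖ ^ 2 / 2 + 1 / 2)) v) :
    SuperOn (Ioo t₀ (t₀ + τ))
      (fun z t p => inner ℝ (b z t) p + (‖p‖ ^ 2 / (2 * (1 - μ)) + 1 / 2))
      (fun z t => 1 * v z t + (penalty k (k / τ) ρ B t₀ (z, t) + η)) := by
  have hpart : ∀ (z : Space m) t, HasPartialsAt
      (fun q => penalty k (k / τ) ρ B t₀ q + η) z t _ _ := fun z t =>
    (hasPartialsAt_penalty k (k / τ) ρ B t₀ z t).add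
      (HasPartialsAt.of_time (hasDerivAt_const t η) z)
  refine hv.const_mul_add one_pos ((contDiff_penalty k (k / τ) ρ B t₀).add contDiff_const)
    hpart fun z t ht p => ?_
  have htt : 0 ≤ (t - t₀) / τ ∧ (t - t₀) / τ ≤ 1 :=
    ⟨div_nonneg (by linarith [ht.1]) hτ.le, (div_le_one hτ).2 (by linarith [ht.2])⟩
  set κ := k + k / τ * (t - t₀) with hκ
  have hκ' : κ = k + k * ((t - t₀) / τ) := by rw [hκ]; ring
  have hκ0 : 0 ≤ κ := by rw [hκ']; nlinarith [mul_nonneg hk.le htt.1]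
  have hκ2 : κ ≤ 2 * k := by rw [hκ']; nlinarith [mul_le_mul_of_nonneg_left htt.2 hk.le]
  set r := jap z - ρ + B * (t - t₀) with hr
  have hQ := norm_gradient_penalty_le (r := r) hκ0 z
  rw [add_zero, add_zero, one_mul, one_smul, inner_add_right]
  set q := κ • (2 * max r 0) • (jap z)⁻¹ • z with hq
  have hbq := hb.neg_le_inner z (ht₀.trans ht.1.le) q
  -- The ball shrinks at speed `B`, so the time derivative of the penalty absorbs the drift term.
  have hBQ := mul_le_mul_of_nonneg_left hQ hb.bound_nonneg
  have hP : ‖p‖ ≤ ‖p + q‖ + ‖q‖ := by simpa using norm_sub_le (p + q) q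
  have hP2 : ‖p‖ ^ 2 ≤ ‖p + q‖ ^ 2 / (1 - μ) + ‖q‖ ^ 2 / μ :=
    (pow_le_pow_left₀ (norm_nonneg p) hP 2).trans (add_sq_le_div_add_div hμ0 hμ1 _ _)
  -- The growth `k / τ` of the penalty's coefficient pays for the square of its gradient; here `8 *
  -- k * τ ≤ μ` is needed.
  have hQ2 : ‖q‖ ^ 2 / μ ≤ 2 * (k / τ * posSq r) := by
    have h1 : ‖q‖ ^ 2 ≤ (2 * k * (2 * max r 0)) ^ 2 :=
      pow_le_pow_left₀ (norm_nonneg q)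
        (hQ.trans (mul_le_mul_of_nonneg_right hκ2 (by positivity))) 2
    rw [div_le_iff₀ hμ0]
    refine h1.trans ?_
    have h2 : (2 * k * (2 * max r 0)) ^ 2 = 2 * (k / τ * posSq r) * (8 * k * τ) := by
      rw [posSq]; field_simp; ring
    rw [h2]
    exact mul_le_mul_of_nonneg_left hτk
      (mul_nonneg two_pos.le (mul_nonneg (by positivity) (posSq_nonneg r)))
  have h5 : ‖p + q‖ ^ 2 / (2 * (1 - μ)) = ‖p + q‖ ^ 2 / (1 - μ) / 2 := by
    rw [mul_comm, div_mul_eq_div_div]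
  rw [h5]
  linarith

/-- A super-solution of the G-equation plus a lateral penalty is a super-solution. -/
theorem SuperOn.add_penalty_geometric (hb : IsDrift b B L) {v : Space m → ℝ → ℝ} {I : Set ℝ}
    (hI : I ⊆ Ioi 0) {k η ρ : ℝ} (hk : 0 ≤ k)
    (hv : SuperOn I (fun z t p => inner ℝ (b z t) p + ‖p‖) v) :
    SuperOn I (fun z t p => inner ℝ (b z t) p + (‖p‖ - η))
      (fun z t => 1 * v z t + (penalty k 0 ρ (B + 1) 0 (z, t) + η * (1 + t))) := by
  have hpart : ∀ (z : Space m) t, HasPartialsAt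
      (fun q => penalty k 0 ρ (B + 1) 0 q + η * (1 + q.2)) z t _ _ := fun z t =>
    (hasPartialsAt_penalty k 0 ρ (B + 1) 0 z t).add
      (HasPartialsAt.of_time (((hasDerivAt_id t).const_add 1).const_mul η) z)
  refine hv.const_mul_add one_pos ((contDiff_penalty k 0 ρ (B + 1) 0).add
    (contDiff_const.mul (contDiff_const.add contDiff_snd))) hpart fun z t ht p => ?_
  set r := jap z - ρ + (B + 1) * (t - 0) with hr
  rw [zero_mul, zero_mul, add_zero, zero_add, add_zero, one_mul, one_smul, inner_add_right, mul_one]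
  have hQ := norm_gradient_penalty_le (r := r) hk z
  set q := k • (2 * max r 0) • (jap z)⁻¹ • z with hq
  have hbq := hb.neg_le_inner z (le_of_lt (hI ht)) q
  have hBQ := mul_le_mul_of_nonneg_left hQ hb.bound_nonneg
  have hP : ‖p‖ ≤ ‖p + q‖ + ‖q‖ := by simpa using norm_sub_le (p + q) q
  -- The shrinking speed `B + 1` pays for the drift and for the change of `‖p‖` by at most `‖q‖`.
  linarith

end

section

variable {m : ℕ} {b : Space m → ℝ → Space m} {B L : ℝ}

/-! ### Comparison for the eikonal equation -/

/-- Comparison for a short time under a quadratic growth condition. -/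
theorem le_short_time (hb : IsDrift b B L) {U v : Space m → ℝ → ℝ}
    (hU : ContinuousOn (Function.uncurry U) (univ ×ˢ Ioi 0))
    (hv : ContinuousOn (Function.uncurry v) (univ ×ˢ Ioi 0))
    {t₀ τ μ C η : ℝ} (ht₀ : 0 ≤ t₀) (hτ : 0 < τ) (hμ0 : 0 < μ) (hμ1 : μ < 1) (hC : 0 < C)
    (hη : 0 < η) (hτC : 32 * C * τ ≤ μ)
    (hsub : SubOn (Ioo t₀ (t₀ + τ))
      (fun z t p => inner ℝ (b z t) p + (‖p‖ ^ 2 / (2 * (1 - μ)) + 1 / 2) + η) U)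
    (hsup : SuperOn (Ioo t₀ (t₀ + τ))
      (fun z t p => inner ℝ (b z t) p + (‖p‖ ^ 2 / 2 + 1 / 2)) v)
    (hgrowth : ∀ z, ∀ t ∈ Ioc t₀ (t₀ + τ), U z t - v z t ≤ C * jap z ^ 2)
    (hinit : ∀ R η', 0 < η' → ∀ᶠ σ in 𝓝[>] t₀, ∀ z, ‖z‖ ≤ R → U z σ ≤ v z σ + η')
    (z : Space m) {t : ℝ} (ht : t ∈ Ioo t₀ (t₀ + τ)) : U z t ≤ v z t := by
  refine le_of_forall_pos_le_add fun η' hη' => ?_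
  -- The margin `B * τ` keeps `z` inside the shrinking ball for the whole time step.
  set ρ := jap z + B * τ with hρ
  have hBτ : 0 ≤ B * τ := mul_nonneg hb.bound_nonneg hτ.le
  have hz1 := one_le_jap z
  obtain ⟨σ, hσ, hσt⟩ := ((hinit (2 * ρ) η' hη').and (Ioo_mem_nhdsGT ht.1)).exists
  have hσ0 : 0 < σ := ht₀.trans_lt hσt.1
  have hIoo : Ioo σ (t₀ + τ) ⊆ Ioo t₀ (t₀ + τ) := Ioo_subset_Ioo_left hσt.1.le
  -- On the lateral boundary `‖x‖ = 2 * ρ` one has `jap x - ρ ≥ jap x / 2`, so the coefficient `4 *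
  -- C` makes the penalty dominate `C * jap x ^ 2`.
  have hsup' := SuperOn.add_penalty_eikonal (η := η') (ρ := ρ) (k := 4 * C) hb ht₀ hτ hμ0 hμ1
    (by positivity) (by linarith) hsup
  have hVc : ContinuousOn (Function.uncurry fun z t =>
      1 * v z t + (penalty (4 * C) (4 * C / τ) ρ B t₀ (z, t) + η'))
      (Metric.closedBall (0 : Space m) (2 * ρ) ×ˢ Icc σ (t₀ + τ)) := by
    have h1 := continuousOn_const (c := (1 : ℝ)).mul
      (ContinuousOn.mono_cylinder hv hσ0 (2 * ρ) (t₀ + τ))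
    exact h1.add (((contDiff_penalty _ _ _ _ _).continuous.add continuous_const).continuousOn)
  have key := le_of_le_parabolicBoundary (F := fun p => ‖p‖ ^ 2 / (2 * (1 - μ)) + 1 / 2)
    hb.lip_nonneg hη
    (fun x x' r r' hr hr' => hb.lip x x' r r' (hσ0.le.trans hr) (hσ0.le.trans hr'))
    (ContinuousOn.mono_cylinder hU hσ0 (2 * ρ) (t₀ + τ)) hVc
    (fun ψ hψ x r hr => hsub ψ hψ x r (hIoo hr)) (fun ψ hψ x r hr => hsup' ψ hψ x r (hIoo hr))
    ?_ (z := z) (t := t) (by linarith [norm_le_jap z]) ⟨hσt.2.le, ht.2⟩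
  · have h0 : penalty (4 * C) (4 * C / τ) ρ B t₀ (z, t) = 0 := by
      have : jap z - ρ + B * (t - t₀) ≤ 0 := by
        have := mul_le_mul_of_nonneg_left (show t - t₀ ≤ τ by linarith [ht.2]) hb.bound_nonneg
        linarith
      simp only [penalty, posSq_of_nonpos this, mul_zero]
    rw [h0] at key
    linarith
  · intro x r hx hr hor
    have hr0 : 0 ≤ r - t₀ := by linarith [hr.1, hσt.1]
    have hk : 4 * C ≤ 4 * C + 4 * C / τ * (r - t₀) := by
      have : 0 ≤ 4 * C / τ * (r - t₀) := by positivity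
      linarith
    have hpen : 4 * C * posSq (jap x - ρ) ≤ penalty (4 * C) (4 * C / τ) ρ B t₀ (x, r) :=
      mul_le_mul hk (posSq_mono (by linarith [mul_nonneg hb.bound_nonneg hr0]))
        (posSq_nonneg _) (by linarith)
    rcases hor with h | h
    · have h1 := norm_le_jap x
      have h2 : 0 ≤ jap x - ρ := by linarith
      rw [posSq_of_nonneg h2] at hpen
      have h3 : (jap x / 2) ^ 2 ≤ (jap x - ρ) ^ 2 :=
        pow_le_pow_left₀ (by linarith) (by linarith) 2
      have h4 := mul_le_mul_of_nonneg_left h3 hC.le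
      have h5 := hgrowth x r ⟨hσt.1.trans_le hr.1, hr.2⟩
      linarith
    · subst h
      have h1 := hσ x hx
      have h2 := mul_nonneg (by positivity : 0 ≤ 4 * C) (posSq_nonneg (jap x - ρ))
      linarith

/-- A convex combination of a sub-solution of the eikonal equation and an explicit strict
sub-solution solves a slightly less coercive equation strictly. -/
theorem IsSubsolution.convexComb (hb : IsDrift b B L) {φ : Space m → ℝ → ℝ} {I : Set ℝ}
    (hI : I ⊆ Ioi 0)
    (hφ : IsSubsolution (fun z t p => inner ℝ (b z t) p + (‖p‖ ^ 2 / 2 + 1 / 2)) φ)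
    {l K K₀ : ℝ} (hl0 : 0 < l) (hl1 : l ≤ 1 / 2) (hK : 0 ≤ K) :
    SubOn I (fun z t p => inner ℝ (b z t) p + (‖p‖ ^ 2 / (2 * (1 - l / 2)) + 1 / 2) + l)
      (fun z t => (1 - l) * φ z t +
        l * ((-K) * jap z + (K₀ + -(B * K + 2 * K ^ 2 + 2) * t))) := by
  -- The summands pay for the drift, for the term `2 * l * K ^ 2` in `h4`, and for the strictness
  -- `l` together with the share `l / 2` of the constant `1 / 2`.
  set K' := B * K + 2 * K ^ 2 + 2 with hK'
  have hpart : ∀ (z : Space m) t, HasPartialsAt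
      (fun q => l * ((-K) * jap q.1 + (K₀ + -K' * q.2))) z t _ _ := fun z t =>
    (((HasPartialsAt.of_space (hasGradientAt_jap z) t).const_mul (-K)).add
      (HasPartialsAt.of_time (((hasDerivAt_id t).const_mul (-K')).const_add K₀) z)).const_mul l
  refine (hφ.subOn hI).const_mul_add (by linarith) (contDiff_const.mul
    ((contDiff_const.mul (contDiff_jap.comp contDiff_fst)).add
      (contDiff_const.add (contDiff_const.mul contDiff_snd)))) hpart fun z t ht p => ?_
  rw [mul_zero, zero_add, mul_one, add_zero, inner_add_right, inner_smul_right]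
  set g := (-K) • (jap z)⁻¹ • z with hg
  have hgK : ‖g‖ ≤ K := by
    rw [hg, norm_smul, norm_neg, Real.norm_of_nonneg hK]
    exact mul_le_of_le_one_right hK (norm_gradient_jap_le z)
  have h1 := hb.inner_le z (le_of_lt (hI ht)) (l • g)
  rw [norm_smul, Real.norm_of_nonneg hl0.le] at h1
  have h1' : B * (l * ‖g‖) ≤ B * (l * K) :=
    mul_le_mul_of_nonneg_left (mul_le_mul_of_nonneg_left hgK hl0.le) hb.bound_nonneg
  have h2 : ‖(1 - l) • p + l • g‖ ≤ (1 - l) * ‖p‖ + l * K := by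
    refine (norm_add_le _ _).trans ?_
    rw [norm_smul, norm_smul, Real.norm_of_nonneg hl0.le, Real.norm_of_nonneg (by linarith)]
    linarith [mul_le_mul_of_nonneg_left hgK hl0.le]
  have h3 := pow_le_pow_left₀ (norm_nonneg _) h2 2
  have h4 : ‖(1 - l) • p + l • g‖ ^ 2 / (2 * (1 - l / 2)) ≤
      (1 - l) * (‖p‖ ^ 2 / 2) + 2 * l * K ^ 2 := by
    rw [div_le_iff₀ (by linarith)]
    refine h3.trans ?_
    set P := ‖p‖
    have e : ((1 - l) * (P ^ 2 / 2) + 2 * l * K ^ 2) * (2 * (1 - l / 2)) -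
        ((1 - l) * P + l * K) ^ 2 =
        l * ((1 - l) / 2 * (P - 2 * K) ^ 2 + (2 - l) * K ^ 2) := by ring
    have : 0 ≤ l * ((1 - l) / 2 * (P - 2 * K) ^ 2 + (2 - l) * K ^ 2) := by
      have : 0 ≤ 1 - l := by linarith
      have : 0 ≤ 2 - l := by linarith
      positivity
    linarith
  have h5 : l * -K' = -(B * (l * K)) - 2 * l * K ^ 2 - 2 * l := by rw [hK']; ring
  rw [h5]
  linarith

/-- Comparison of two solutions of the eikonal equation that are ordered initially by a Lipschitz
function. No growth condition is imposed at positive times. -/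
theorem eikonal_comparison (hb : IsDrift b B L) {φ v : Space m → ℝ → ℝ} {φ₀ : Space m → ℝ}
    (hφc : ContinuousOn (Function.uncurry φ) (univ ×ˢ Ioi 0))
    (hvc : ContinuousOn (Function.uncurry v) (univ ×ˢ Ioi 0))
    (hφ : IsSubsolution (fun z t p => inner ℝ (b z t) p + (‖p‖ ^ 2 / 2 + 1 / 2)) φ)
    (hvsub : IsSubsolution (fun z t p => inner ℝ (b z t) p + (‖p‖ ^ 2 / 2 + 1 / 2)) v)
    (hvsup : IsSupersolution (fun z t p => inner ℝ (b z t) p + (‖p‖ ^ 2 / 2 + 1 / 2)) v)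
    {K : NNReal} (hlip : LipschitzWith K φ₀)
    (hφi : ∀ R η, 0 < η → ∀ᶠ σ in 𝓝[>] (0 : ℝ), ∀ z, ‖z‖ ≤ R → φ z σ ≤ φ₀ z + η)
    (hvi : ∀ R η, 0 < η → ∀ᶠ σ in 𝓝[>] (0 : ℝ), ∀ z, ‖z‖ ≤ R → φ₀ z ≤ v z σ + η)
    (z : Space m) {t : ℝ} (ht : 0 < t) : φ z t ≤ v z t := by
  have hB := hb.bound_nonneg
  set T := t + 1 with hT
  have hφ₀ : ∀ x, |φ₀ x - φ₀ 0| ≤ K * jap x := fun x => by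
    have h1 := hlip.dist_le_mul x 0
    rw [Real.dist_eq, dist_zero_right] at h1
    exact h1.trans (mul_le_mul_of_nonneg_left (norm_le_jap x) K.2)
  -- A line with `q = 0`, started just after time `0`.
  have hup : ∀ x, ∀ s ∈ Ioc 0 T, φ x s ≤ φ₀ x + B ^ 2 / 2 * T := by
    intro x s hs
    refine le_of_forall_pos_le_add fun η hη => ?_
    obtain ⟨σ, h1, h2⟩ := ((hφi ‖x‖ η hη).and (Ioo_mem_nhdsGT hs.1)).exists
    have h3 := hφ.le_along_line hb hφc h2.1 h2.2.le x 0
    rw [smul_zero, add_zero, norm_zero, add_zero] at h3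
    have h4 := h1 x le_rfl
    have h5 : B ^ 2 / 2 * (s - σ) ≤ B ^ 2 / 2 * T :=
      mul_le_mul_of_nonneg_left (by linarith [hs.2, h2.1]) (by positivity)
    linarith
  -- The line from `(x, s)` to `(0, T + 1)`: the upper growth bound at its end is a lower bound at
  -- its start. Aiming at `T + 1` keeps the travel time at least one, hence the slope at most `‖x‖`.
  have hlow : ∀ x, ∀ s ∈ Ioc 0 T, v 0 (T + 1) - (B + 1) ^ 2 / 2 * (T + 1) * jap x ^ 2 ≤ v x s := by
    intro x s hs
    have hd : 1 ≤ T + 1 - s := by linarith [hs.2]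
    have h1 := hvsub.le_along_line hb hvc hs.1 (show s ≤ T + 1 by linarith [hs.2]) x
      (-((T + 1 - s)⁻¹ • x))
    rw [smul_neg, smul_inv_smul₀ (by linarith), add_neg_cancel, norm_neg, norm_smul, norm_inv,
      Real.norm_of_nonneg (by linarith)] at h1
    have h2 : (T + 1 - s)⁻¹ * ‖x‖ ≤ jap x :=
      (mul_le_of_le_one_left (norm_nonneg x) (inv_le_one_of_one_le₀ hd)).trans (norm_le_jap x)
    have h3 : B + (T + 1 - s)⁻¹ * ‖x‖ ≤ (B + 1) * jap x := by
      have := mul_le_mul_of_nonneg_left (one_le_jap x) hB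
      linarith
    have h4 := pow_le_pow_left₀ (by positivity) h3 2
    have h5 : (B + (T + 1 - s)⁻¹ * ‖x‖) ^ 2 / 2 * (T + 1 - s) ≤
        ((B + 1) * jap x) ^ 2 / 2 * (T + 1) :=
      mul_le_mul (by linarith) (by linarith [hs.1]) (by linarith) (by positivity)
    have h6 : ((B + 1) * jap x) ^ 2 / 2 * (T + 1) = (B + 1) ^ 2 / 2 * (T + 1) * jap x ^ 2 := by
      ring
    linarith
  set K' := B * K + 2 * (K : ℝ) ^ 2 + 2 with hK'
  have hK'0 : 0 ≤ K' := by positivity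
  have main : ∀ l : ℝ, 0 < l → l ≤ 1 / 2 →
      (1 - l) * φ z t + l * ((-(K : ℝ)) * jap z + (φ₀ 0 + -K' * t)) ≤ v z t := by
    intro l hl0 hl1
    set U : Space m → ℝ → ℝ := fun z t =>
      (1 - l) * φ z t + l * ((-(K : ℝ)) * jap z + (φ₀ 0 + -K' * t)) with hU
    have hl1' : 0 ≤ 1 - l := by linarith
    -- By the Lipschitz bound the explicit sub-solution lies below `φ₀`, so the convex combination
    -- inherits upper bounds of the form `φ₀ + c`.
    have hUφ : ∀ x s c, 0 ≤ c → 0 ≤ s → φ x s ≤ φ₀ x + c → U x s ≤ φ₀ x + c := by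
      intro x s c hc hs hle
      have h1 := mul_le_mul_of_nonneg_left hle hl1'
      have h2 : (-(K : ℝ)) * jap x + (φ₀ 0 + -K' * s) ≤ φ₀ x := by
        have := (abs_le.1 (hφ₀ x)).1
        have := mul_nonneg hK'0 hs
        linarith
      have h3 := mul_le_mul_of_nonneg_left h2 hl0.le
      have h4 := mul_nonneg hl0.le hc
      simp only [hU]
      linarith
    have hUc : ContinuousOn (Function.uncurry U) (univ ×ˢ Ioi 0) := by
      have h1 := continuousOn_const (c := 1 - l).mul hφc
      refine h1.add (Continuous.continuousOn ?_)
      have := (contDiff_jap (m := m)).continuous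
      fun_prop
    set C := |φ₀ 0| + K + B ^ 2 / 2 * T + |v 0 (T + 1)| + (B + 1) ^ 2 / 2 * (T + 1) with hC
    have hT0 : 0 < T := by positivity
    have hC0 : 0 < C := by positivity
    have hgrowth : ∀ x, ∀ s ∈ Ioc 0 T, U x s - v x s ≤ C * jap x ^ 2 := by
      intro x s hs
      have h1 := hUφ x s _ (by positivity) hs.1.le (hup x s hs)
      have h2 := hlow x s hs
      have hj := one_le_jap x
      have hj2 : 1 ≤ jap x ^ 2 := one_le_pow₀ hj
      have hj3 : jap x ≤ jap x ^ 2 := by nlinarith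
      have h3 := (abs_le.1 (hφ₀ x)).2
      have h4 := le_abs_self (φ₀ 0)
      have h5 := neg_abs_le (v 0 (T + 1))
      have h6 := mul_le_mul_of_nonneg_left hj2
        (show 0 ≤ |φ₀ 0| + B ^ 2 / 2 * T + |v 0 (T + 1)| by positivity)
      have h7 := mul_le_mul_of_nonneg_left hj3 K.2
      simp only [NNReal.val_eq_coe] at h7
      rw [hC]
      linarith
    set τ := min (l / 2 / (32 * C)) 1 with hτ
    have hτ0 : 0 < τ := lt_min (by positivity) one_pos
    have hτC : 32 * C * τ ≤ l / 2 := by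
      have := mul_le_mul_of_nonneg_left (min_le_left (l / 2 / (32 * C)) 1)
        (show 0 ≤ 32 * C by positivity)
      rwa [mul_div_cancel₀ _ (by positivity : 32 * C ≠ 0)] at this
    have hstep : ∀ t₀, 0 ≤ t₀ → t₀ ≤ t →
        (∀ R η', 0 < η' → ∀ᶠ σ in 𝓝[>] t₀, ∀ z, ‖z‖ ≤ R → U z σ ≤ v z σ + η') →
        ∀ x, ∀ s ∈ Ioo t₀ (t₀ + τ), U x s ≤ v x s := by
      intro t₀ h0 h1 hin x s hs
      have hτ1 : τ ≤ 1 := min_le_right _ _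
      have hI : Ioo t₀ (t₀ + τ) ⊆ Ioi 0 := fun r hr => h0.trans_lt hr.1
      exact le_short_time hb hUc hvc h0 hτ0 (by linarith) (by linarith) hC0 hl0 hτC
        (hφ.convexComb hb hI hl0 hl1 K.2) (hvsup.superOn hI)
        (fun y r hr => hgrowth y r ⟨h0.trans_lt hr.1, by linarith [hr.2]⟩) hin x hs
    -- Windows of length `τ` advance by `τ / 2`, so each one starts inside its predecessor, where
    -- the order is already known.
    have hind : ∀ n : ℕ, n * (τ / 2) ≤ t → ∀ x,
        ∀ s ∈ Ioo (n * (τ / 2)) (n * (τ / 2) + τ), U x s ≤ v x s := by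
      intro n
      induction n with
      | zero =>
        intro _
        simp only [Nat.cast_zero, zero_mul]
        refine hstep 0 le_rfl ht.le fun R η' hη' => ?_
        filter_upwards [hφi R (η' / 2) (by linarith), hvi R (η' / 2) (by linarith),
          self_mem_nhdsWithin] with σ h1 h2 h3 x hx
        have := hUφ x σ (η' / 2) (by linarith) (le_of_lt h3) (h1 x hx)
        have := h2 x hx
        linarith
      | succ n ih =>
        intro hn
        push_cast at hn ⊢
        have e : (n + 1 : ℝ) * (τ / 2) = n * (τ / 2) + τ / 2 := by ring
        rw [e] at hn ⊢
        have ih' := ih (by linarith)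
        refine hstep _ (by positivity) hn fun R η' hη' => ?_
        have hmem : Ioo ((n : ℝ) * (τ / 2) + τ / 2) (n * (τ / 2) + τ) ∈
            𝓝[>] ((n : ℝ) * (τ / 2) + τ / 2) := Ioo_mem_nhdsGT (by linarith)
        filter_upwards [hmem] with σ hσ x _
        have := ih' x σ ⟨by linarith [hσ.1], hσ.2⟩
        linarith
    -- The windows are open: the last index with `n * (τ / 2)` strictly below `t` is the ceiling
    -- minus one.
    set n := ⌈t / (τ / 2)⌉₊ - 1 with hn
    have hc0 : 0 < ⌈t / (τ / 2)⌉₊ := Nat.ceil_pos.2 (by positivity)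
    have hcast : (n : ℝ) = (⌈t / (τ / 2)⌉₊ : ℝ) - 1 := by
      rw [hn, Nat.cast_sub hc0, Nat.cast_one]
    have h1 := Nat.le_ceil (t / (τ / 2))
    have h2 := Nat.ceil_lt_add_one (show 0 ≤ t / (τ / 2) by positivity)
    rw [div_le_iff₀ (by positivity)] at h1
    have h3 : (n : ℝ) * (τ / 2) < t := by
      rw [← lt_div_iff₀ (by positivity)]; linarith
    refine hind n h3.le z t ⟨h3, ?_⟩
    rw [hcast]
    linarith
  refine le_of_forall_pos_le_add fun η hη => ?_
  set D := φ z t - ((-(K : ℝ)) * jap z + (φ₀ 0 + -K' * t)) with hD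
  set l := min (1 / 2) (η / (|D| + 1)) with hl
  have hl0 : 0 < l := lt_min (by norm_num) (by positivity)
  have h1 := main l hl0 (min_le_left _ _)
  have h2 : l * D ≤ η := by
    calc l * D ≤ l * (|D| + 1) := mul_le_mul_of_nonneg_left (by linarith [le_abs_self D]) hl0.le
      _ ≤ η / (|D| + 1) * (|D| + 1) :=
        mul_le_mul_of_nonneg_right (min_le_right _ _) (by positivity)
      _ = η := div_mul_cancel₀ _ (by positivity)
  rw [hD] at h2
  linarith

end

section

variable {m : ℕ} {b : Space m → ℝ → Space m} {B L : ℝ}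

/-! ### Attainment of initial data -/

/-- Compactness of the ball makes the time threshold uniform in `z`. -/
theorem eventually_forall_ball {P : Space m → ℝ → Prop}
    (hP : ∀ z, ∀ᶠ q : Space m × ℝ in 𝓝[closedHalf (Space m)] (z, 0), P q.1 q.2) (R : ℝ) :
    ∀ᶠ σ in 𝓝[>] (0 : ℝ), ∀ z, ‖z‖ ≤ R → P z σ := by
  have h : ∀ᶠ σ in 𝓝 (0 : ℝ), ∀ z ∈ Metric.closedBall (0 : Space m) R, 0 ≤ σ → P z σ := by
    refine (isCompact_closedBall (0 : Space m) R).eventually_forall_of_forall_eventually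
      (P := fun σ z => 0 ≤ σ → P z σ) fun z _ => ?_
    have h1 := eventually_nhdsWithin_iff.1 (hP z)
    have h2 : Tendsto (Prod.swap : ℝ × Space m → Space m × ℝ) (𝓝 (0, z)) (𝓝 (z, 0)) :=
      continuous_swap.tendsto _
    filter_upwards [h2.eventually h1] with q hq h0
    exact hq ⟨mem_univ _, h0⟩
  filter_upwards [nhdsWithin_le_nhds h, self_mem_nhdsWithin] with σ h1 h2 z hz
  exact h1 z (mem_closedBall_zero_iff.2 hz) (le_of_lt h2)

variable {H : Space m → ℝ → Space m → ℝ} {v₀ g : Space m → ℝ} {v : Space m → ℝ → ℝ}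

/-- The datum may be discontinuous, but a continuous majorant also bounds its upper envelope, which
controls `v` near time `0`. -/
theorem IsSolution.eventually_le (hv : IsSolution H v₀ v) (hg : Continuous g)
    (hle : ∀ z, v₀ z ≤ g z) (R : ℝ) {η : ℝ} (hη : 0 < η) :
    ∀ᶠ σ in 𝓝[>] (0 : ℝ), ∀ z, ‖z‖ ≤ R → v z σ ≤ g z + η := by
  refine eventually_forall_ball (P := fun z σ => v z σ ≤ g z + η) (fun z => ?_) R
  have h1 : limsup (fun z' => (v₀ z' : EReal)) (𝓝 z) ≤ (g z : EReal) := by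
    have h2 : Tendsto (fun z' => (g z' : EReal)) (𝓝 z) (𝓝 (g z : EReal)) :=
      (continuous_coe_real_ereal.comp hg).tendsto z
    rw [← h2.limsup_eq]
    exact limsup_le_limsup (Eventually.of_forall fun z' => EReal.coe_le_coe_iff.2 (hle z'))
  have h3 : limsup (fun q : Space m × ℝ => (v q.1 q.2 : EReal)) (𝓝[closedHalf (Space m)] (z, 0))
      < ((g z + η / 2 : ℝ) : EReal) :=
    ((hv.initial_upper z).trans h1).trans_lt (EReal.coe_lt_coe_iff.2 (by linarith))
  have h4 : ∀ᶠ q : Space m × ℝ in 𝓝[closedHalf (Space m)] (z, 0), g z - η / 2 < g q.1 :=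
    nhdsWithin_le_nhds (((hg.comp continuous_fst).tendsto (z, (0 : ℝ))).eventually
      (lt_mem_nhds (show g z - η / 2 < g z by linarith)))
  filter_upwards [eventually_lt_of_limsup_lt h3, h4] with q h5 h6
  have := EReal.coe_lt_coe_iff.1 h5
  linarith

theorem IsSolution.eventually_ge (hv : IsSolution H v₀ v) (hg : Continuous g)
    (hle : ∀ z, g z ≤ v₀ z) (R : ℝ) {η : ℝ} (hη : 0 < η) :
    ∀ᶠ σ in 𝓝[>] (0 : ℝ), ∀ z, ‖z‖ ≤ R → g z ≤ v z σ + η := by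
  refine eventually_forall_ball (P := fun z σ => g z ≤ v z σ + η) (fun z => ?_) R
  have h1 : (g z : EReal) ≤ liminf (fun z' => (v₀ z' : EReal)) (𝓝 z) := by
    have h2 : Tendsto (fun z' => (g z' : EReal)) (𝓝 z) (𝓝 (g z : EReal)) :=
      (continuous_coe_real_ereal.comp hg).tendsto z
    rw [← h2.liminf_eq]
    exact liminf_le_liminf (Eventually.of_forall fun z' => EReal.coe_le_coe_iff.2 (hle z'))
  have h3 : ((g z - η / 2 : ℝ) : EReal) <
      liminf (fun q : Space m × ℝ => (v q.1 q.2 : EReal)) (𝓝[closedHalf (Space m)] (z, 0)) :=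
    lt_of_lt_of_le (EReal.coe_lt_coe_iff.2 (by linarith)) (h1.trans (hv.initial_lower z))
  have h4 : ∀ᶠ q : Space m × ℝ in 𝓝[closedHalf (Space m)] (z, 0), g q.1 < g z + η / 2 :=
    nhdsWithin_le_nhds (((hg.comp continuous_fst).tendsto (z, (0 : ℝ))).eventually
      (gt_mem_nhds (show g z < g z + η / 2 by linarith)))
  filter_upwards [eventually_lt_of_lt_liminf h3, h4] with q h5 h6
  have := EReal.coe_lt_coe_iff.1 h5
  linarith

/-! ### Comparison of level sets for the G-equation -/

/-- Replaces `log (1 + x)` by a polynomial with the same value and slope at `0`; unlike the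
logarithm, it yields a test function that is `C¹` everywhere. -/
theorem sub_two_mul_sq_le_log {x : ℝ} (hx : -(1 / 2) ≤ x) : x - 2 * x ^ 2 ≤ Real.log (1 + x) := by
  have h0 : 0 < 1 + x := by linarith
  refine le_trans ?_ (Real.one_sub_inv_le_log_of_pos h0)
  rw [show 1 - (1 + x)⁻¹ = x / (1 + x) by field_simp; ring, le_div_iff₀ h0]
  nlinarith [mul_nonneg (sq_nonneg x) (show 0 ≤ 1 + 2 * x by linarith)]

/-- Exponentials of super-solutions of the G-equation are super-solutions. -/
theorem SuperOn.exp_geometric {I : Set ℝ} {G : Space m → ℝ → ℝ}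
    (hG : SuperOn I (fun z t p => inner ℝ (b z t) p + ‖p‖) G) {k : ℝ} (hk : 0 < k) (c : ℝ) :
    SuperOn I (fun z t p => inner ℝ (b z t) p + ‖p‖) (fun z t => Real.exp (k * G z t + c)) := by
  intro ψ hψ z t ht hmin
  set M := Real.exp (k * G z t + c) with hM
  have hM0 : 0 < M := Real.exp_pos _
  set x : Space m × ℝ → ℝ := fun q => M⁻¹ * (ψ q - ψ (z, t)) with hx
  have hxc : ContDiff ℝ 1 x := contDiff_const.mul (hψ.sub contDiff_const)
  have hx0 : x (z, t) = 0 := by simp [hx]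
  have hP := HasPartialsAt.of_contDiff hψ z t
  set a := deriv (fun s => ψ (z, s)) t
  set p := gradient (fun z' => ψ (z', t)) z
  have hxP : HasPartialsAt x z t (M⁻¹ * a) (M⁻¹ • p) := by
    have := (hP.add (HasPartialsAt.of_time (hasDerivAt_const t (-ψ (z, t))) z)).const_mul M⁻¹
    simpa only [add_zero, ← sub_eq_add_neg] using this
  have hyP : HasPartialsAt (fun q => k⁻¹ * (x q - 2 * x q ^ 2)) z t
      (k⁻¹ * (M⁻¹ * a)) (k⁻¹ • M⁻¹ • p) := by
    have hd : HasDerivAt (fun y : ℝ => y - 2 * y ^ 2) 1 (x (z, t)) := by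
      rw [hx0]
      have := (hasDerivAt_id' (0 : ℝ)).fun_sub (((hasDerivAt_id' (0 : ℝ)).fun_pow 2).const_mul 2)
      simpa using this
    have := (HasPartialsAt.comp (k := fun y : ℝ => y - 2 * y ^ 2) hd hxP).const_mul k⁻¹
    simpa only [one_mul, one_smul] using this
  have hloc : IsLocalMin (fun q : Space m × ℝ => G q.1 q.2 - k⁻¹ * (x q - 2 * x q ^ 2)) (z, t) := by
    have hnear : ∀ᶠ q in 𝓝 (z, t), -(1 / 2) < x q :=
      (hxc.continuous.tendsto (z, t)).eventually (lt_mem_nhds (by rw [hx0]; norm_num))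
    filter_upwards [hmin, hnear] with q hq hqx
    have h1 : 1 + x q ≤ Real.exp (k * G q.1 q.2 + c) / M := by
      rw [le_div_iff₀ hM0]
      have : (1 + x q) * M = M + (ψ q - ψ (z, t)) := by
        simp only [hx]; field_simp
      rw [this]
      linarith
    have h2 := (sub_two_mul_sq_le_log hqx.le).trans (Real.log_le_log (by linarith) h1)
    rw [hM, ← Real.exp_sub, Real.log_exp] at h2
    have h3 : k⁻¹ * (x q - 2 * x q ^ 2) ≤ G q.1 q.2 - G z t := by
      rw [inv_mul_le_iff₀ hk]; linarith
    simp only [hx0]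
    linarith
  have key := hG _ (contDiff_const.mul (hxc.sub (contDiff_const.mul (hxc.pow 2)))) z t ht hloc
  rw [hyP.deriv_eq, hyP.gradient_eq] at key
  simp only at key
  rw [inner_smul_right, inner_smul_right, norm_smul, norm_smul,
    Real.norm_of_nonneg (inv_pos.2 hk).le, Real.norm_of_nonneg (inv_pos.2 hM0).le] at key
  -- Homogeneity of degree one: the positive factor `k⁻¹ * M⁻¹` comes out of the whole inequality.
  have e : k⁻¹ * (M⁻¹ * a) + (k⁻¹ * (M⁻¹ * inner ℝ (b z t) p) + k⁻¹ * (M⁻¹ * ‖p‖)) =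
      (k⁻¹ * M⁻¹) * (a + (inner ℝ (b z t) p + ‖p‖)) := by ring
  rw [e] at key
  exact nonneg_of_mul_nonneg_right key (mul_pos (inv_pos.2 hk) (inv_pos.2 hM0))

/-- Comparison of a sub-solution and a super-solution of the G-equation. By finite speed of
propagation, only the initial order on a large ball matters. -/
theorem geometric_comparison (hb : IsDrift b B L) {v W : Space m → ℝ → ℝ}
    (hvc : ContinuousOn (Function.uncurry v) (univ ×ˢ Ioi 0))
    (hWc : ContinuousOn (Function.uncurry W) (univ ×ˢ Ioi 0))
    (hv : SubOn (Ioi 0) (fun z t p => inner ℝ (b z t) p + ‖p‖) v)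
    (hW : SuperOn (Ioi 0) (fun z t p => inner ℝ (b z t) p + ‖p‖) W)
    (z : Space m) {t η : ℝ} (ht : 0 < t) (hη : 0 < η)
    (hinit : ∀ᶠ σ in 𝓝[>] (0 : ℝ), ∀ x, ‖x‖ ≤ jap z + (B + 1) * t + 1 → v x σ ≤ W x σ + η) :
    v z t ≤ W z t + η * (1 + t) := by
  have hB := hb.bound_nonneg
  set ρ := jap z + (B + 1) * t with hρ
  have hBt : 0 ≤ (B + 1) * t := by positivity
  obtain ⟨σ, hσ, hσt⟩ := (hinit.and (Ioo_mem_nhdsGT ht)).exists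
  have hσ0 : 0 < σ := hσt.1
  set K := Metric.closedBall (0 : Space m) (ρ + 1) ×ˢ Icc σ (t + 1) with hK
  have hvK : ContinuousOn (Function.uncurry v) K := ContinuousOn.mono_cylinder hvc hσ0 _ _
  have hWK : ContinuousOn (Function.uncurry W) K := ContinuousOn.mono_cylinder hWc hσ0 _ _
  obtain ⟨k, hk⟩ := ((isCompact_closedBall (0 : Space m) (ρ + 1)).prod
    (isCompact_Icc (a := σ) (b := t + 1))).exists_bound_of_continuousOn (hvK.sub hWK)
  have hzρ : ‖z‖ ≤ ρ + 1 := by linarith [norm_le_jap z]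
  have hk0 : 0 ≤ k := (norm_nonneg _).trans
    (hk (z, t) ⟨mem_closedBall_zero_iff.2 hzρ, hσt.2.le, by linarith⟩)
  have hI : Ioo σ (t + 1) ⊆ Ioi 0 := fun r hr => hσ0.trans hr.1
  have hsup := SuperOn.add_penalty_geometric (η := η) (ρ := ρ) hb hI hk0
    (fun ψ hψ x r hr => hW ψ hψ x r (hI hr))
  -- Relative to the Hamiltonian lowered by `η`, the sub-solution is strict; the source `η * (1 +
  -- t)` added to `W` compensates the lowering.
  have hsub : SubOn (Ioo σ (t + 1)) (fun z t p => inner ℝ (b z t) p + (‖p‖ - η) + η) v :=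
    fun ψ hψ x r hr hmax => by
      have := hv ψ hψ x r (hI hr) hmax
      linarith
  have hVc : ContinuousOn (Function.uncurry fun x r =>
      1 * W x r + (penalty k 0 ρ (B + 1) 0 (x, r) + η * (1 + r))) K := by
    have h1 := continuousOn_const (c := (1 : ℝ)).mul hWK
    refine h1.add (((contDiff_penalty _ _ _ _ _).continuous.add ?_).continuousOn)
    fun_prop
  have key := le_of_le_parabolicBoundary (F := fun p => ‖p‖ - η) hb.lip_nonneg hη
    (fun x x' r r' hr hr' => hb.lip x x' r r' (hσ0.le.trans hr) (hσ0.le.trans hr'))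
    hvK hVc hsub hsup ?_ hzρ (t := t) ⟨hσt.2.le, by linarith⟩
  · have h0 : penalty k 0 ρ (B + 1) 0 (z, t) = 0 := by
      have : jap z - ρ + (B + 1) * (t - 0) ≤ 0 := by rw [hρ]; linarith
      simp only [penalty, posSq_of_nonpos this, mul_zero]
    rw [h0] at key
    linarith
  · intro x r hx hr hor
    have hr0 : 0 ≤ r := hσ0.le.trans hr.1
    have hηr : 0 ≤ η * r := mul_nonneg hη.le hr0
    have hpen : penalty k 0 ρ (B + 1) 0 (x, r) = k * posSq (jap x - ρ + (B + 1) * r) := by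
      simp [penalty]
    rw [hpen]
    rcases hor with h | h
    -- At radius `ρ + 1` the penalty is at least `k`, the bound for `|v - W|` on the cylinder.
    · have h1 : 1 ≤ jap x - ρ + (B + 1) * r := by
        have := norm_le_jap x
        have : 0 ≤ (B + 1) * r := by positivity
        linarith
      have h2 : 1 ≤ posSq (jap x - ρ + (B + 1) * r) := by
        rw [posSq_of_nonneg (by linarith)]; exact one_le_pow₀ h1
      have h3 := mul_le_mul_of_nonneg_left h2 hk0
      have h4 : v x r - W x r ≤ k := (abs_le.1 (hk (x, r) ⟨mem_closedBall_zero_iff.2 hx, hr⟩)).2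
      linarith
    · subst h
      have h1 := hσ x hx
      have h2 := mul_nonneg hk0 (posSq_nonneg (jap x - ρ + (B + 1) * r))
      linarith

end

section

variable {m : ℕ} {b : Space m → ℝ → Space m} {B L : ℝ}

/-! ### Front-like data -/

theorem IsProfile.strictMono {g : ℝ → ℝ} (hg : IsProfile g) : StrictMono g := by
  have hc : Continuous g := hg.locallyLipschitz.continuous
  refine StrictMonoOn.Iic_union_Ici (a := 0) ?_ ?_
  · refine strictMonoOn_of_deriv_pos (convex_Iic 0) hc.continuousOn fun y hy => ?_
    rw [interior_Iic] at hy
    exact hg.deriv_pos y (ne_of_lt hy)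
  · refine strictMonoOn_of_deriv_pos (convex_Ici 0) hc.continuousOn fun y hy => ?_
    rw [interior_Ici] at hy
    exact hg.deriv_pos y (ne_of_gt hy)

/-- For `y ≤ 0` the left side is nonpositive, and near `0` it is below `η`. Beyond that, `lo` has a
positive lower bound, so a large `k` works up to `R`. -/
theorem IsProfile.exists_le_exp {lo hi : ℝ → ℝ} (hlo : IsProfile lo) (hhi : IsProfile hi) (R : ℝ)
    {η : ℝ} (hη : 0 < η) : ∃ k, 0 < k ∧ ∀ y ≤ R, hi y ≤ η * Real.exp (k * lo y) := by
  obtain ⟨r, hr, hrη⟩ : ∃ r, 0 < r ∧ hi r < η := by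
    have h1 : ∀ᶠ y in 𝓝[>] (0 : ℝ), hi y < η :=
      nhdsWithin_le_nhds ((hhi.locallyLipschitz.continuous.tendsto 0).eventually
        (gt_mem_nhds (by rwa [hhi.map_zero])))
    obtain ⟨r, h, h0⟩ := (h1.and self_mem_nhdsWithin).exists
    exact ⟨r, h0, h⟩
  have hlor : 0 < lo r := hlo.map_zero ▸ hlo.strictMono hr
  refine ⟨(|hi R| / η + 1) / lo r, by positivity, fun y hy => ?_⟩
  set k := (|hi R| / η + 1) / lo r with hk
  have hk0 : 0 < k := by positivity
  rcases le_total y 0 with h | h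
  · have : hi y ≤ 0 := hhi.map_zero ▸ hhi.strictMono.monotone h
    exact this.trans (by positivity)
  · rcases le_total y r with h' | h'
    · have h1 := hhi.strictMono.monotone h'
      have h2 : 0 ≤ lo y := hlo.map_zero ▸ hlo.strictMono.monotone h
      have h3 : 1 ≤ Real.exp (k * lo y) := Real.one_le_exp (by positivity)
      have := mul_le_mul_of_nonneg_left h3 hη.le
      linarith
    · have h1 := hhi.strictMono.monotone hy
      have h2 := mul_le_mul_of_nonneg_left (hlo.strictMono.monotone h') hk0.le
      rw [hk, div_mul_cancel₀ _ hlor.ne', ← hk] at h2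
      have h3 := mul_le_mul_of_nonneg_left
        ((Real.add_one_le_exp (|hi R| / η)).trans (Real.exp_le_exp.2 (by linarith))) hη.le
        (c := Real.exp (k * lo y))
      have h4 : η * (|hi R| / η + 1) = |hi R| + η := by field_simp
      have h5 := le_abs_self (hi R)
      linarith

theorem yPart_le_norm (z : Space m) : yPart z ≤ ‖z‖ :=
  (le_abs_self _).trans (PiLp.norm_apply_le z (Fin.last m))

theorem continuous_yPart : Continuous (yPart : Space m → ℝ) := by
  unfold yPart; fun_prop

/-! ### The advection is a drift -/

/-- Since `fderivWithin` is `0` by default where differentiability fails, the derivative bound in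
`HasFiniteC1Norm` yields a Lipschitz estimate only together with this. -/
theorem advection_differentiableOn {uperp : Space m → ℝ → EuclideanSpace ℝ (Fin m)}
    {upar : EuclideanSpace ℝ (Fin m) → ℝ → ℝ} {w : ℝ → ℝ}
    (hperp : ContDiffOn ℝ 2 (Function.uncurry uperp) (closedHalf (Space m)))
    (hpar : ContDiffOn ℝ 2 (Function.uncurry upar) (closedHalf (EuclideanSpace ℝ (Fin m))))
    (hw : ContDiff ℝ 1 w) :
    DifferentiableOn ℝ (Function.uncurry (advection uperp upar w)) (closedHalf (Space m)) := by
  rw [differentiableOn_euclidean]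
  intro i
  refine Fin.lastCases ?_ (fun j => ?_) i
  · have hx : Differentiable ℝ (fun q : Space m × ℝ => (xPart q.1, q.2)) := by
      refine Differentiable.prodMk ?_ differentiable_snd
      rw [differentiable_euclidean]
      intro j
      simp only [xPart]
      fun_prop
    have h1 : DifferentiableOn ℝ (fun q : Space m × ℝ => upar (xPart q.1) q.2)
        (closedHalf (Space m)) :=
      (hpar.differentiableOn two_ne_zero).comp hx.differentiableOn fun q hq => ⟨mem_univ _, hq.2⟩
    have hy : Differentiable ℝ (fun q : Space m × ℝ => yPart q.1) := by
      unfold yPart; fun_prop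
    have h2 : Differentiable ℝ (fun q : Space m × ℝ => w (yPart q.1)) :=
      (hw.differentiable one_ne_zero).comp hy
    refine (h1.mul h2.differentiableOn).congr fun q _ => ?_
    simp [Function.uncurry, advection]
  · have h1 := differentiableOn_euclidean.1 (hperp.differentiableOn two_ne_zero) j
    refine h1.congr fun q _ => ?_
    simp [Function.uncurry, advection]

theorem epsPow_nonneg {ε : ℝ} (hε : 0 < ε) (α : ℝ≥0∞) : 0 ≤ epsPow ε α := by
  unfold epsPow
  split_ifs
  · exact le_rfl
  · positivity

/-- Mean value inequality on the convex half-space; the factor `1 + e` accounts for the rescaling of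
time. -/
theorem exists_isDrift {u : Space m → ℝ → Space m}
    (hd : DifferentiableOn ℝ (Function.uncurry u) (closedHalf (Space m)))
    (hu : HasFiniteC1Norm u) {ε : ℝ} (hε : 0 < ε) (α : ℝ≥0∞) :
    ∃ B L, IsDrift (fun z t => ε • u z (epsPow ε α * t)) B L := by
  obtain ⟨C, hC⟩ := hu
  set e := epsPow ε α with he
  have he0 : 0 ≤ e := epsPow_nonneg hε α
  have hC0 : 0 ≤ C := (norm_nonneg _).trans (hC 0 0 le_rfl).1
  have hconv : Convex ℝ (closedHalf (Space m)) := convex_univ.prod (convex_Ici 0)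
  have hlip : ∀ z z' t t', 0 ≤ t → 0 ≤ t' → ‖u z t - u z' t'‖ ≤ C * (‖z - z'‖ + |t - t'|) := by
    intro z z' t t' ht ht'
    have h1 := hconv.norm_image_sub_le_of_norm_fderivWithin_le hd
      (fun q hq => (hC q.1 q.2 hq.2).2) (show (z', t') ∈ closedHalf (Space m) from ⟨mem_univ _, ht'⟩)
      (show (z, t) ∈ closedHalf (Space m) from ⟨mem_univ _, ht⟩)
    refine h1.trans (mul_le_mul_of_nonneg_left ?_ hC0)
    rw [Prod.mk_sub_mk, Prod.norm_mk, Real.norm_eq_abs]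
    exact max_le_add_of_nonneg (norm_nonneg _) (abs_nonneg _)
  refine ⟨ε * C, ε * (C * (1 + e)), by positivity, by positivity, fun z t ht => ?_,
    fun z z' t t' ht ht' => ?_⟩
  · rw [norm_smul, Real.norm_of_nonneg hε.le]
    exact mul_le_mul_of_nonneg_left (hC z _ (by positivity)).1 hε.le
  · rw [← smul_sub, norm_smul, Real.norm_of_nonneg hε.le, mul_assoc, mul_assoc]
    refine mul_le_mul_of_nonneg_left ((hlip z z' _ _ (by positivity) (by positivity)).trans ?_) hε.le
    refine mul_le_mul_of_nonneg_left ?_ hC0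
    rw [← mul_sub, abs_mul, abs_of_nonneg he0]
    nlinarith [norm_nonneg (z - z'), abs_nonneg (t - t'), mul_nonneg he0 (norm_nonneg (z - z'))]

theorem geometricH_eq (u : Space m → ℝ → Space m) (ε : ℝ) (α : ℝ≥0∞) :
    geometricH u ε α = fun z t p => inner ℝ (ε • u z (epsPow ε α * t)) p + ‖p‖ := by
  funext z t p
  rw [geometricH, real_inner_smul_left]

theorem eikonalH_eq (u : Space m → ℝ → Space m) (ε : ℝ) (α : ℝ≥0∞) :
    eikonalH u ε α =
      fun z t p => inner ℝ (ε • u z (epsPow ε α * t)) p + (‖p‖ ^ 2 / 2 + 1 / 2) := by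
  funext z t p
  rw [eikonalH, real_inner_smul_left, add_assoc]

/-! ### Inclusions of the burned regions -/

/-- A front-like solution of the eikonal equation is nonpositive where a front-like solution of the
G-equation is. -/
theorem eikonal_nonpos_of_geometric_nonpos (hb : IsDrift b B L) {G₀ v₀ : Space m → ℝ}
    {G v : Space m → ℝ → ℝ}
    (hG : IsSolution (fun z t p => inner ℝ (b z t) p + ‖p‖) G₀ G) (hGc : Continuous G₀)
    (hGf : FrontLike G₀)
    (hv : IsSolution (fun z t p => inner ℝ (b z t) p + (‖p‖ ^ 2 / 2 + 1 / 2)) v₀ v)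
    (hvf : FrontLike v₀) {t : ℝ} (ht : 0 < t) {z : Space m} (hz : G z t ≤ 0) : v z t ≤ 0 := by
  obtain ⟨lo, _, hlo, _, hlow⟩ := hGf.exists_profiles
  obtain ⟨_, hi, _, hhi, hup⟩ := hvf.exists_profiles
  have hvsub : SubOn (Ioi 0) (fun z t p => inner ℝ (b z t) p + ‖p‖) v :=
    -- `‖p‖ ≤ ‖p‖ ^ 2 / 2 + 1 / 2`, with equality only at `‖p‖ = 1`.
    (hv.sub.subOn Subset.rfl).mono_ham fun x s _ p => by nlinarith [sq_nonneg (‖p‖ - 1)]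
  have main : ∀ η : ℝ, 0 < η → v z t ≤ η * (Real.exp 1 + (1 + t)) := by
    intro η hη
    set R := jap z + (B + 1) * t + 1
    obtain ⟨k, hk, hkle⟩ := hlo.exists_le_exp hhi R hη
    -- The extra `1` in the exponent absorbs the error `1 / k` with which `G` attains its datum at
    -- small times.
    set W : Space m → ℝ → ℝ := fun x s => Real.exp (k * G x s + (1 + Real.log η)) with hW
    have hWeq : ∀ x s, W x s = η * Real.exp (k * G x s + 1) := fun x s => by
      simp only [hW]
      rw [← add_assoc, Real.exp_add, Real.exp_log hη, mul_comm]
    have hWc : ContinuousOn (Function.uncurry W) (univ ×ˢ Ioi 0) := by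
      have h1 := (continuousOn_const (c := k).mul hG.continuousOn).add
        (continuousOn_const (c := 1 + Real.log η))
      exact Real.continuous_exp.comp_continuousOn h1
    have hWsup := SuperOn.exp_geometric (hG.super.superOn (I := Ioi 0) Subset.rfl) hk
      (1 + Real.log η)
    have key := geometric_comparison hb hv.continuousOn hWc hvsub hWsup z ht hη ?_
    · have h1 : W z t ≤ η * Real.exp 1 := by
        rw [hWeq]
        refine mul_le_mul_of_nonneg_left (Real.exp_le_exp.2 ?_) hη.le
        linarith [mul_nonpos_of_nonneg_of_nonpos hk.le hz]
      linarith
    · filter_upwards [hv.eventually_le (hhi.locallyLipschitz.continuous.comp continuous_yPart)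
        (fun x => (hup x).2) R hη,
        hG.eventually_ge hGc (fun _ => le_rfl) R (inv_pos.2 hk)] with σ h1 h2 x hx
      have h3 := h1 x hx
      have h4 := mul_le_mul_of_nonneg_left ((hlow x).1.trans (h2 x hx)) hk.le
      rw [mul_add, mul_inv_cancel₀ hk.ne'] at h4
      have h5 := hkle (yPart x) ((yPart_le_norm x).trans hx)
      have h6 := mul_le_mul_of_nonneg_left (Real.exp_le_exp.2 h4) hη.le
      rw [hWeq]
      simp only [Function.comp] at h3
      linarith
  refine le_of_forall_pos_le_add fun δ hδ => ?_
  have hc : 0 < Real.exp 1 + (1 + t) := by positivity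
  have := main (δ / (Real.exp 1 + (1 + t))) (by positivity)
  rwa [div_mul_cancel₀ _ hc.ne', ← zero_add δ] at this

end

end FrontProp

end


/-! ### The inclusions for almost every realization -/

theorem proposition2p4 {Ω : Type*} [MeasurableSpace Ω] (P : Measure Ω) [IsProbabilityMeasure P]
    (m : ℕ) (w : ℝ → Ω → ℝ)
    (uperp : FrontProp.Space m → ℝ → EuclideanSpace ℝ (Fin m))
    (upar : EuclideanSpace ℝ (Fin m) → ℝ → ℝ)
    (hu : FrontProp.IsAdmissible P w uperp upar) :
    ∀ᵐ ω ∂P, ∀ u : FrontProp.Space m → ℝ → FrontProp.Space m,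
      u = FrontProp.advection uperp upar (fun y => w y ω) →
      ∀ (ε : ℝ) (α : ℝ≥0∞), 0 < ε → 1 ≤ α →
      ∀ χG χv : EuclideanSpace ℝ (Fin m) → ℝ → ℝ → ℝ,
      FrontProp.IsPTW (FrontProp.geometricH u ε α) ε χG →
      FrontProp.IsPTW (FrontProp.eikonalH u ε α) ε χv →
      ∀ (v₀ : FrontProp.Space m → ℝ) (v : FrontProp.Space m → ℝ → ℝ),
      FrontProp.FrontLike v₀ →
      (∀ z, FrontProp.ptw ε χv z 0 ≤ v₀ z) →
      FrontProp.IsSolution (FrontProp.eikonalH u ε α) v₀ v →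
      ∀ t : ℝ, 0 ≤ t →
        {z | FrontProp.ptw ε χG z t ≤ 0} ⊆ {z | v z t ≤ 0} ∧
        {z | v z t ≤ 0} ⊆ {z | FrontProp.ptw ε χv z t ≤ 0} := by
  obtain ⟨M, -, hM⟩ := hu.noise.bounded
  filter_upwards [hM, hu.finiteC1] with ω hω hfin
  rintro u rfl ε α hε - χG χv hG hE v₀ v hv₀ hle hv t ht
  obtain ⟨B, L, hb⟩ := FrontProp.exists_isDrift
    (FrontProp.advection_differentiableOn hu.perp hu.par hω.1) hfin hε α
  rw [FrontProp.geometricH_eq] at hG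
  rw [FrontProp.eikonalH_eq] at hE hv
  obtain ⟨KG, hKG⟩ := hG.lipschitz
  obtain ⟨KE, hKE⟩ := hE.lipschitz
  -- The comparison results concern positive times; at `t = 0` the inclusions are read off the data,
  -- the first from the signs of the profiles.
  rcases ht.eq_or_lt with rfl | ht
  · constructor
    · intro z hz
      obtain ⟨lo, _, hlo, _, hlow⟩ := hG.frontLike.exists_profiles
      obtain ⟨_, hi, _, hhi, hup⟩ := hv₀.exists_profiles
      have hy : FrontProp.yPart z ≤ 0 :=
        hlo.strictMono.le_iff_le.1 (((hlow z).1.trans hz).trans hlo.map_zero.ge)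
      show v z 0 ≤ 0
      rw [hv.initial z, ← hhi.map_zero]
      exact (hup z).2.trans (hhi.strictMono.monotone hy)
    · intro z hz
      have hz' : v z 0 ≤ 0 := hz
      rw [hv.initial z] at hz'
      exact (hle z).trans hz'
  · constructor
    · intro z hz
      exact FrontProp.eikonal_nonpos_of_geometric_nonpos hb hG.solution hKG.continuous
        hG.frontLike hv hv₀ ht hz
    · intro z hz
      refine le_trans ?_ (show v z t ≤ 0 from hz)
      exact FrontProp.eikonal_comparison hb hE.solution.continuousOn hv.continuousOn
        hE.solution.sub hv.sub hv.super hKE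
        (fun R η hη => hE.solution.eventually_le hKE.continuous (fun _ => le_rfl) R hη)
        (fun R η hη => hv.eventually_ge hKE.continuous hle R hη) z ht
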